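/- Let $D\ge 2$ be an integer, let $E_0,\dots,E_D\in\mathbb R$ and let $\beta\in\mathbb R$. Let $\mathbb T_N$ be the finite set of plane (rooted, ordered) trees on $N$ vertices in which every vertex has at most $D$ children. For a vertex $v$ write $\deg(v)$ for its number of children and $h(v)$ for its distance to the root. For $N\ge 1$ let $\mu_N$ be the probability measure on $\mathbb T_N$ with $$\mu_N\{T\}=\frac{e^{-\beta E(T)}}{Z_N},\qquad E(T)=\sum_{v\in V(T)}E_{\deg(v)},\qquad Z_N=\sum_{T\in\mathbb T_N}e^{-\beta E(T)} .$$ For $n\ge 0$ let $S_n$ be the set of plane trees of height exactly $n$ (the maximal distance of a vertex to the root) in which every vertex has at most $D$ children, and let $\pi_nT$ be the subtree of $T$ spanned by the vertices of height at most $n$. Let $\Delta$ be the set of $p=(p_0,\dots,p_D)\in[0,1]^{D+1}$ with $\sum_i p_i=\sum_i i\,p_i=1$, and let $J(p)=\sum_{i=0}^D p_i\ln p_i+\beta\sum_{i=0}^D p_iE_i$ (with $0\ln 0=0$). Then $J$ attains its minimum over $\Delta$ at a unique point $p^*$, and there are $C,\rho>0$ with $p^*_i=Ce^{-\beta E_i}\rho^i$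 for $i=0,\dots,D$. Here $\rho$ is the unique positive solution of $\sum_{i=0}^D e^{-\beta E_i}\rho^i=\sum_{i=0}^D i\,e^{-\beta E_i}\rho^i$, and $1/C$ is the common value of the two sums. Put $\sigma=e^{J(p^*)}$. For every $n\ge 0$ the measures $\mu_N\pi_n^{-1}$, which are carried by $S_n$ for all sufficiently large $N$, converge in total variation as $N\to\infty$ to a (unique) probability measure $P_n$ on $S_n$. For $\tau\in S_n$ let $k$ be the number of vertices of $\tau$ of height $n$, let $m$ be the number of vertices of $\tau$ of height less than $n$, and let $\bar E(\tau)=\sum_{v\in V(\tau),\,h(v)<n}E_{\deg(v)}$. Then $$P_n\{\tau\}=Q_n\,k\,\rho^k\,\sigma^m e^{-\beta\bar E(\tau)}\qquad(\tau\in S_n),$$ where the normalising constant is $Q_n=C/\sigma$ for every $n$; that is, $$P_n\{\tau\}=C\,k\,e^{-\beta\bar E(\tau)}\rho^k\sigma^{m-1}\qquad(\tau\in S_n).$$ -/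

import Mathlib

noncomputable section

namespace GibbsTree

open MeasureTheory Filter Topology

/-- Finite plane (ordered, rooted) trees: a tree is the list of the subtrees at the children of its
root.  Equality is equality of plane trees, i.e. it respects the parent-child relation and the
order of the children. -/
inductive PlaneTree : Type
  | node : List PlaneTree → PlaneTree

/-- What the energy model sees of a vertex: its distance to the root and its branching number. -/
structure Vertex where
  /-- Distance to the root. -/
  height : ℕ
  /-- Branching number, i.e. number of children. -/
  deg : ℕ

namespace PlaneTree

/-- The vertices of a tree, one entry for each vertex, in depth-first order. -/
def vertices : PlaneTree → List Vertex
  | node ts => ⟨0, ts.length⟩ ::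
      (ts.flatMap fun t => vertices t).map fun v => ⟨v.height + 1, v.deg⟩

/-- The number of vertices. -/
def order (T : PlaneTree) : ℕ := T.vertices.length

/-- The maximal height of a vertex. -/
def height (T : PlaneTree) : ℕ := (T.vertices.map Vertex.height).foldr max 0

/-- All branching numbers are at most `D`. -/
def BranchingLE (D : ℕ) (T : PlaneTree) : Prop := ∀ v ∈ T.vertices, v.deg ≤ D

/-- The energy `E(T)`: the sum over all vertices `v` of `E (deg v)`.  For trees with branching
bounded by `D` only the values `E 0, …, E D` matter. -/
def energy (E : ℕ → ℝ) (T : PlaneTree) : ℝ := (T.vertices.map fun v => E v.deg).sum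

/-- The energy contributed by the vertices of height less than `n`. -/
def energyBelow (E : ℕ → ℝ) (n : ℕ) (T : PlaneTree) : ℝ :=
  ((T.vertices.filter fun v => v.height < n).map fun v => E v.deg).sum

/-- The number of vertices of height `n`. -/
def numAt (n : ℕ) (T : PlaneTree) : ℕ := T.vertices.countP fun v => v.height = n

/-- The number of vertices of height less than `n`. -/
def numBelow (n : ℕ) (T : PlaneTree) : ℕ := T.vertices.countP fun v => v.height < n

/-- The neighborhood of the root of radius `n`: the subtree spanned by the vertices of height at
most `n`. -/
def trunc : ℕ → PlaneTree → PlaneTree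
  | 0, _ => node []
  | n + 1, node ts => node (ts.map fun t => trunc n t)

/-- All sets of trees are measurable. -/
instance : MeasurableSpace PlaneTree := ⊤

instance : DiscreteMeasurableSpace PlaneTree := ⟨fun _ => trivial⟩

theorem order_node (ts : List PlaneTree) : (node ts).order = (ts.map order).sum + 1 := by
  simp only [order, vertices, List.length_cons, List.length_map, List.length_flatMap]
  rfl

theorem finite_forests (N : ℕ) : {ts : List PlaneTree | (ts.map order).sum ≤ N}.Finite := by
  induction N with
  | zero =>
    refine (Set.finite_singleton []).subset ?_
    rintro (_ | ⟨⟨us⟩, ts⟩) h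
    · rfl
    · simp [order_node] at h
  | succ N ih =>
    refine ((Set.finite_singleton []).union (Set.Finite.image2 List.cons (ih.image node) ih)).subset
      ?_
    rintro (_ | ⟨⟨us⟩, ts⟩) h
    · exact Or.inl rfl
    · simp only [Set.mem_ofPred_eq, List.map_cons, List.sum_cons, order_node] at h
      refine Or.inr ⟨node us, ⟨us, ?_, rfl⟩, ts, ?_, rfl⟩ <;> simp only [Set.mem_ofPred_eq] <;> omega

theorem finite_trees (D N : ℕ) : {T : PlaneTree | T.order = N ∧ T.BranchingLE D}.Finite := by
  refine ((finite_forests N).image node).subset ?_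
  rintro ⟨ts⟩ ⟨h, -⟩
  rw [order_node] at h
  exact ⟨ts, by simp only [Set.mem_ofPred_eq]; omega, rfl⟩

end PlaneTree

open PlaneTree

/-- The finite set `𝕋_N(D)` of plane trees on `N` vertices with branching numbers at most `D`. -/
def trees (D N : ℕ) : Finset PlaneTree := (finite_trees D N).toFinset

/-- The set `S_n` of plane trees of height `n` with branching numbers at most `D`. -/
def treesOfHeight (D n : ℕ) : Set PlaneTree := {τ | τ.height = n ∧ τ.BranchingLE D}

/-- The partition function `Z_N`. -/
def partitionFn (D : ℕ) (E : ℕ → ℝ) (β : ℝ) (N : ℕ) : ℝ :=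
  ∑ T ∈ trees D N, Real.exp (-β * T.energy E)

/-- The Gibbs measure `μ_N` on `𝕋_N(D)`, as a measure on the countable space of all finite plane
trees: it gives mass `exp (-β E(T)) / Z_N` to every `T ∈ 𝕋_N(D)`. -/
def gibbs (D : ℕ) (E : ℕ → ℝ) (β : ℝ) (N : ℕ) : Measure PlaneTree :=
  ∑ T ∈ trees D N,
    ENNReal.ofReal (Real.exp (-β * T.energy E) / partitionFn D E β N) • Measure.dirac T

/-- Total variation distance of two finite measures. -/
def tvDist {Ω : Type*} [MeasurableSpace Ω] (μ ν : Measure Ω) : ℝ :=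
  ⨆ A : {A : Set Ω // MeasurableSet A}, |μ.real A - ν.real A|

/-- `P` is the thermodynamic limit at radius `n`: a probability measure on `S_n` to which the
push-forwards of the Gibbs measures `μ_N` under the radius-`n` neighborhood of the root, which are
carried by `S_n` for all large `N`, converge in total variation. -/
structure IsLimitMeasure (D : ℕ) (E : ℕ → ℝ) (β : ℝ) (n : ℕ) (P : Measure PlaneTree) : Prop where
  isProbabilityMeasure : IsProbabilityMeasure P
  carried : P (treesOfHeight D n)ᶜ = 0
  eventually_carried :
    ∀ᶠ N in atTop, (gibbs D E β N).map (trunc n) (treesOfHeight D n)ᶜ = 0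
  tendsto :
    Tendsto (fun N => tvDist ((gibbs D E β N).map (trunc n)) P) atTop (𝓝 0)

/-- The set `Δ` of probability vectors `(p_0, …, p_D)` with mean `1`. -/
def meanOneSimplex (D : ℕ) : Set (Fin (D + 1) → ℝ) :=
  {p | (∀ i, p i ∈ Set.Icc (0 : ℝ) 1) ∧ ∑ i, p i = 1 ∧ ∑ i : Fin (D + 1), ((i : ℕ) : ℝ) * p i = 1}

/-- The entropy `H(p) = -∑ p_i ln p_i`, with `0 ln 0 = 0`. -/
def entropy {D : ℕ} (p : Fin (D + 1) → ℝ) : ℝ := -∑ i, p i * Real.log (p i)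

/-- The functional `J(p) = -H(p) + β ∑ p_i E_i`. -/
def freeEnergy {D : ℕ} (E : ℕ → ℝ) (β : ℝ) (p : Fin (D + 1) → ℝ) : ℝ :=
  -entropy p + β * ∑ i, p i * E i

/-- The unnormalised weight `k ρ^k σ^m exp (-β Ē(τ))` of a tree `τ` with `k` vertices of height `n`
and `m` vertices of height less than `n`. -/
def weight (E : ℕ → ℝ) (β ρ σ : ℝ) (n : ℕ) (τ : PlaneTree) : ℝ :=
  τ.numAt n * ρ ^ τ.numAt n * σ ^ τ.numBelow n * Real.exp (-β * τ.energyBelow E n)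

end GibbsTree

end

noncomputable section

namespace GibbsTree

open MeasureTheory Filter Topology PlaneTree

/-! Write `w i = exp (-β E i)`, `φ(x) = ∑ w i x^i`, and let `T` be the generating function of all
admissible trees by order, so that `T = X φ(T)` (`allGF_eq`). A tree whose radius-`n` neighborhood
is `τ` arises by growing an independent tree at each of the `k` vertices of height `n`. The
probability of `τ` under the pushed-forward Gibbs measure is therefore `exp (-β Ē(τ)) [x^N] X^m T^k
/ [x^N] T` (`treeGF_trunc`, `map_gibbs_real_singleton`).

Lagrange inversion (`otter_dwass`) turns `[x^N] T^k` into `(k/N) [x^(N-k)] φ^N`. Tilting `φ` at the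
critical `ρ` makes `C w i ρ^i` a mean-one probability law, and the local limit theorem
(`local_limit`) gives `[x^N] T^k ~ c k ρ^k N^(-3/2) (Cρ)^(-N)` with `c` independent of `k`. In the
ratio everything cancels except `k ρ^(k-1) (Cρ)^m` (`tendsto_coeff_ratio`).

On `Δ`, the functional `J` equals the relative entropy with respect to that same law plus `ln (Cρ)`.
Hence the law is the unique minimiser and `σ = Cρ`. Since `S_n` is finite, pointwise convergence
already gives total variation convergence, and no mass is lost, which fixes `Q_n = 1/ρ = C/σ`. -/

/-! ### Lagrange inversion for powers -/

section Lagrange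

open PowerSeries

/-- The Otter–Dwass formula: if `T = X φ(T)`, then `N [x^N] T^k = k [x^(N-k)] φ^N`. -/
theorem otter_dwass {K : Type*} [Field K] [CharZero K] (w : ℕ → K) (d : ℕ) (φ T : K⟦X⟧)
    (hφ : φ = ∑ i ∈ Finset.range d, C (w i) * X ^ i)
    (hT : T = X * ∑ i ∈ Finset.range d, C (w i) * T ^ i) (N k : ℕ) :
    N * coeff N (T ^ k) = k * coeff N (X ^ k * φ ^ N) := by
  have hrec : ∀ N k, coeff (N + 1) (T ^ (k + 1)) =
      ∑ i ∈ Finset.range d, w i * coeff N (T ^ (k + i)) := by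
    intro N k
    have : T ^ (k + 1) = X * ∑ i ∈ Finset.range d, C (w i) * T ^ (k + i) := by
      rw [pow_succ]
      nth_rewrite 2 [hT]
      rw [mul_left_comm, Finset.mul_sum]
      congr 1
      exact Finset.sum_congr rfl fun i _ => by ring
    rw [this, coeff_succ_X_mul, map_sum]
    simp
  have hT0 : ∀ k, coeff 0 (T ^ k) = coeff 0 (X ^ k : K⟦X⟧) := by
    intro k
    have : constantCoeff T = 0 := by rw [hT]; simp
    rw [coeff_zero_eq_constantCoeff, map_pow, map_pow, this, constantCoeff_X]
  induction N generalizing k with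
  | zero => rcases k with _ | k <;> simp
  | succ N ih =>
    rcases k with _ | k
    · simp [coeff_one]
    rw [hrec]
    have hX : coeff (N + 1) (X ^ (k + 1) * φ ^ (N + 1)) = coeff N (X ^ k * φ ^ (N + 1)) := by
      rw [show X ^ (k + 1) * φ ^ (N + 1) = X * (X ^ k * φ ^ (N + 1)) by ring, coeff_succ_X_mul]
    rw [hX]
    -- The induction hypothesis carries a factor `N`, so it says nothing at `N = 0`; that case is
    -- read off constant terms.
    rcases Nat.eq_zero_or_pos N with rfl | hN
    · simp only [hT0]
      have : ∀ i, w i * coeff 0 (X ^ (k + i) : K⟦X⟧) =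
          constantCoeff (X ^ k : K⟦X⟧) * constantCoeff (C (w i) * X ^ i : K⟦X⟧) := by
        intro i
        simp only [coeff_zero_eq_constantCoeff, pow_add, map_mul, constantCoeff_C]
        ring
      simp only [this, ← Finset.mul_sum, ← map_sum, ← hφ]
      rcases k with _ | k <;> simp
    have hN' : (N : K) ≠ 0 := by exact_mod_cast hN.ne'
    apply mul_left_cancel₀ hN'
    have h1 : (N : K) * (((N + 1 : ℕ) : K) * ∑ i ∈ Finset.range d, w i * coeff N (T ^ (k + i))) =
        ((N : K) + 1) * ∑ i ∈ Finset.range d, w i * ((k + i) * coeff N (X ^ (k + i) * φ ^ N)) := by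
      rw [mul_left_comm, Finset.mul_sum]
      push_cast
      congr 1
      refine Finset.sum_congr rfl fun i _ => ?_
      have := ih (k + i)
      push_cast at this
      rw [← this]; ring
    rw [h1]
    -- Split the factor `k + i`: the `k` part rebuilds `φ`, the `i` part rebuilds `X φ'`.
    have h2 : ∑ i ∈ Finset.range d, w i * ((k + i) * coeff N (X ^ (k + i) * φ ^ N)) =
        k * coeff N (X ^ k * φ ^ (N + 1)) +
          coeff N (X * (X ^ k * (d⁄dX K φ * φ ^ N))) := by
      have e1 : φ ^ (N + 1) = (∑ i ∈ Finset.range d, C (w i) * X ^ i) * φ ^ N := by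
        rw [← hφ]; ring
      have e2 : X * (X ^ k * (d⁄dX K φ * φ ^ N)) =
          ∑ i ∈ Finset.range d, C (w i * i) * (X ^ (k + i) * φ ^ N) := by
        have : X * d⁄dX K φ = ∑ i ∈ Finset.range d, C (w i * i) * X ^ i := by
          rw [hφ, map_sum, Finset.mul_sum]
          refine Finset.sum_congr rfl fun i _ => ?_
          rcases i with _ | i
          · simp
          · rw [Derivation.leibniz, derivative_C, Derivation.leibniz_pow, derivative_X, map_mul,
              map_natCast]
            simp only [smul_eq_mul, nsmul_eq_mul, Nat.add_sub_cancel]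
            ring
        calc _ = X ^ k * (X * d⁄dX K φ) * φ ^ N := by ring
          _ = _ := by
            rw [this, Finset.mul_sum, Finset.sum_mul]
            exact Finset.sum_congr rfl fun i _ => by ring
      rw [e2, e1, Finset.sum_mul, Finset.mul_sum, map_sum, map_sum, Finset.mul_sum,
        ← Finset.sum_add_distrib]
      refine Finset.sum_congr rfl fun i _ => ?_
      rw [show X ^ k * (C (w i) * X ^ i * φ ^ N) = C (w i) * (X ^ (k + i) * φ ^ N) by ring,
        coeff_C_mul, coeff_C_mul]
      ring
    -- The operator `X d/dX` multiplies the coefficient of `x^N` by `N`; apply it to `X^k φ^(N+1)`.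
    -- The factors then combine as `(N+1) k + (N-k) = N (k+1)`.
    have h3 : ((N : K) + 1) * coeff N (X * (X ^ k * (d⁄dX K φ * φ ^ N))) =
        (N - k) * coeff N (X ^ k * φ ^ (N + 1)) := by
      have e : X * d⁄dX K (X ^ k * φ ^ (N + 1)) =
          C (k : K) * (X ^ k * φ ^ (N + 1)) +
            C ((N : K) + 1) * (X * (X ^ k * (d⁄dX K φ * φ ^ N))) := by
        rcases k with _ | k
        · simp [Derivation.leibniz_pow]
          ring
        · simp [Derivation.leibniz_pow]
          ring
      have e' : ∀ f : K⟦X⟧, coeff N (X * d⁄dX K f) = N * coeff N f := by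
        intro f
        obtain ⟨M, rfl⟩ : ∃ M, N = M + 1 := ⟨N - 1, by omega⟩
        rw [coeff_succ_X_mul, coeff_derivative]
        push_cast
        ring
      have := congrArg (coeff N) e
      rw [e', map_add, coeff_C_mul, coeff_C_mul] at this
      linear_combination -this
    rw [h2, mul_add, h3]
    push_cast
    ring

end Lagrange

/-! ### Trees, their heights and their truncations -/

namespace PlaneTree

theorem vertices_node (ts : List PlaneTree) : (node ts).vertices = ⟨0, ts.length⟩ ::
    (ts.flatMap vertices).map fun v => ⟨v.height + 1, v.deg⟩ := by
  rw [vertices]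

theorem height_le_iff {T : PlaneTree} {n : ℕ} : T.height ≤ n ↔ ∀ v ∈ T.vertices, v.height ≤ n := by
  unfold height
  induction T.vertices with
  | nil => simp
  | cons v l ih => simp [ih]

theorem height_node_le_succ {ts : List PlaneTree} {n : ℕ} :
    (node ts).height ≤ n + 1 ↔ ∀ t ∈ ts, t.height ≤ n := by
  simp only [height_le_iff, vertices_node, List.mem_cons, List.mem_map, List.mem_flatMap]
  constructor
  · intro h t ht v hv
    have := h ⟨v.height + 1, v.deg⟩ (Or.inr ⟨v, ⟨t, ht, hv⟩, rfl⟩)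
    simpa using this
  · rintro h _ (rfl | ⟨v, ⟨t, ht, hv⟩, rfl⟩)
    · simp
    · simpa using h t ht v hv

theorem height_node_le_zero {ts : List PlaneTree} : (node ts).height ≤ 0 ↔ ts = [] := by
  simp only [height_le_iff, vertices_node, List.mem_cons, List.mem_map, List.mem_flatMap]
  constructor
  · rintro h
    rcases ts with _ | ⟨⟨us⟩, ts⟩
    · rfl
    · have := h ⟨0 + 1, us.length⟩
        (Or.inr ⟨⟨0, us.length⟩, ⟨node us, by simp, by simp [vertices_node]⟩, rfl⟩)
      simp at this
  · rintro rfl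
    simp

theorem branchingLE_node {D : ℕ} {ts : List PlaneTree} :
    (node ts).BranchingLE D ↔ ts.length ≤ D ∧ ∀ t ∈ ts, t.BranchingLE D := by
  simp only [BranchingLE, vertices_node, List.mem_cons, List.mem_map, List.mem_flatMap]
  constructor
  · intro h
    exact ⟨h _ (Or.inl rfl), fun t ht v hv => h ⟨v.height + 1, v.deg⟩ (Or.inr ⟨v, ⟨t, ht, hv⟩, rfl⟩)⟩
  · rintro ⟨h0, h⟩ _ (rfl | ⟨v, ⟨t, ht, hv⟩, rfl⟩)
    · exact h0
    · exact h t ht v hv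

theorem numAt_zero (T : PlaneTree) : T.numAt 0 = 1 := by
  obtain ⟨ts⟩ := T
  simp [numAt, vertices_node, List.countP_map, Function.comp_def]

theorem numBelow_zero (T : PlaneTree) : T.numBelow 0 = 0 := by
  simp [numBelow]

theorem energyBelow_zero (E : ℕ → ℝ) (T : PlaneTree) : T.energyBelow E 0 = 0 := by
  simp [energyBelow]

theorem numAt_succ_node (n : ℕ) (ts : List PlaneTree) :
    (node ts).numAt (n + 1) = (ts.map (numAt n)).sum := by
  simp only [numAt, vertices_node, List.countP_cons, List.countP_map, List.countP_flatMap,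
    Function.comp_def]
  simp
  rfl

theorem numBelow_succ_node (n : ℕ) (ts : List PlaneTree) :
    (node ts).numBelow (n + 1) = (ts.map (numBelow n)).sum + 1 := by
  simp only [numBelow, vertices_node, List.countP_cons, List.countP_map, List.countP_flatMap,
    Function.comp_def]
  simp
  rfl

theorem energyBelow_succ_node (E : ℕ → ℝ) (n : ℕ) (ts : List PlaneTree) :
    (node ts).energyBelow E (n + 1) = E ts.length + (ts.map (energyBelow E n)).sum := by
  simp only [energyBelow, vertices_node, List.filter_cons, List.filter_map,
    Function.comp_def]
  simp only [Nat.zero_lt_succ, decide_true, if_true, List.map_cons, List.sum_cons,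
    Nat.add_lt_add_iff_right, List.map_map, Function.comp_def]
  congr 1
  induction ts with
  | nil => simp
  | cons t ts ih =>
    rw [List.flatMap_cons, List.filter_append, List.map_append, List.sum_append, ih]
    rfl

theorem energy_node (E : ℕ → ℝ) (ts : List PlaneTree) :
    (node ts).energy E = E ts.length + (ts.map (energy E)).sum := by
  simp only [energy, vertices_node, List.map_cons, List.sum_cons, List.map_map, Function.comp_def]
  congr 1
  induction ts with
  | nil => simp
  | cons t ts ih =>
    rw [List.flatMap_cons, List.map_append, List.sum_append, ih]
    rfl

theorem height_trunc_le (n : ℕ) (T : PlaneTree) : (trunc n T).height ≤ n := by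
  induction n generalizing T with
  | zero => exact height_node_le_zero.2 rfl
  | succ n ih =>
    obtain ⟨ts⟩ := T
    rw [trunc, height_node_le_succ]
    simp only [List.mem_map]
    rintro _ ⟨t, -, rfl⟩
    exact ih t

/-- Truncation at `n + 1` keeps a vertex of height `n + 1` whenever there is one, so the extra level
detects whether the tree is taller than `n`. -/
theorem height_le_of_height_trunc_succ_le {n : ℕ} {T : PlaneTree}
    (h : (trunc (n + 1) T).height ≤ n) : T.height ≤ n := by
  induction n generalizing T with
  | zero =>
    obtain ⟨ts⟩ := T
    rw [trunc, height_node_le_zero, List.map_eq_nil_iff] at h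
    exact height_node_le_zero.2 h
  | succ n ih =>
    obtain ⟨ts⟩ := T
    rw [trunc, height_node_le_succ] at h
    exact height_node_le_succ.2 fun t ht => ih (h _ (List.mem_map_of_mem ht))

theorem height_trunc_of_le {n : ℕ} {T : PlaneTree} (h : n ≤ T.height) :
    (trunc n T).height = n := by
  refine le_antisymm (height_trunc_le n T) ?_
  rcases n with _ | n
  · exact Nat.zero_le _
  · by_contra! h'
    exact absurd (height_le_of_height_trunc_succ_le (Nat.lt_succ_iff.1 h')) (by omega)

theorem BranchingLE.trunc {D : ℕ} {T : PlaneTree} (h : T.BranchingLE D) (n : ℕ) :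
    (trunc n T).BranchingLE D := by
  induction n generalizing T with
  | zero => simp [PlaneTree.trunc, branchingLE_node]
  | succ n ih =>
    obtain ⟨ts⟩ := T
    rw [branchingLE_node] at h
    rw [PlaneTree.trunc, branchingLE_node]
    refine ⟨by simpa using h.1, ?_⟩
    simp only [List.mem_map]
    rintro _ ⟨t, ht, rfl⟩
    exact ih (h.2 t ht)

/-- This finiteness is what reduces total variation to point masses, and what forces trees with many
vertices to be tall. -/
theorem finite_height_le (D n : ℕ) : {T : PlaneTree | T.height ≤ n ∧ T.BranchingLE D}.Finite := by
  induction n with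
  | zero =>
    refine (Set.finite_singleton (node [])).subset ?_
    rintro ⟨ts⟩ ⟨h, -⟩
    rw [height_node_le_zero.1 h]
    rfl
  | succ n ih =>
    have := ih.to_subtype
    refine (((List.finite_length_le {T : PlaneTree | T.height ≤ n ∧ T.BranchingLE D} D).image
      (List.map Subtype.val)).image node).subset ?_
    rintro ⟨ts⟩ ⟨h, h'⟩
    rw [height_node_le_succ] at h
    rw [branchingLE_node] at h'
    lift ts to List {T : PlaneTree | T.height ≤ n ∧ T.BranchingLE D} using
      fun t ht => ⟨h t ht, h'.2 t ht⟩
    exact ⟨_, ⟨ts, by rw [List.length_map] at h'; exact h'.1, rfl⟩, rfl⟩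

end PlaneTree

theorem finite_treesOfHeight (D n : ℕ) : (treesOfHeight D n).Finite :=
  (finite_height_le D n).subset fun _ h => ⟨h.1.le, h.2⟩

theorem mem_trees {D N : ℕ} {T : PlaneTree} : T ∈ trees D N ↔ T.order = N ∧ T.BranchingLE D := by
  simp [trees]

/-- Large trees are truncated to trees of the full height. -/
theorem eventually_trunc_mem (D n : ℕ) :
    ∀ᶠ N in atTop, ∀ T ∈ trees D N, trunc n T ∈ treesOfHeight D n := by
  obtain ⟨B, hB⟩ := ((finite_height_le D n).image order).bddAbove
  filter_upwards [eventually_gt_atTop B] with N hN T hT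
  rw [mem_trees] at hT
  refine ⟨height_trunc_of_le ?_, hT.2.trunc n⟩
  by_contra! h
  have := hB ⟨T, ⟨h.le, hT.2⟩, rfl⟩
  omega

open PlaneTree

/-! ### Weighted generating functions -/

section GenFun

open PowerSeries

/-- The generating function of the weights of the elements of `A`, by size. -/
def genFun {α : Type*} (size : α → ℕ) (wt : α → ℝ) (A : Set α) : ℝ⟦X⟧ :=
  PowerSeries.mk fun N => ∑ᶠ a ∈ {a | a ∈ A ∧ size a = N}, wt a

variable {α β γ : Type*} {sα : α → ℕ} {sβ : β → ℕ} {sγ : γ → ℕ} {wα : α → ℝ} {wβ : β → ℝ}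
  {wγ : γ → ℝ}

theorem genFun_singleton (a : α) (h0 : sα a = 0) (h1 : wα a = 1) : genFun sα wα {a} = 1 := by
  ext N
  rw [genFun, coeff_mk, coeff_one]
  split_ifs with hN
  · have : {b | b ∈ ({a} : Set α) ∧ sα b = N} = {a} := by
      ext b
      simp only [Set.mem_singleton_iff, Set.mem_ofPred_eq]
      exact ⟨fun h => h.1, by rintro rfl; exact ⟨rfl, h0.trans hN.symm⟩⟩
    rw [this, finsum_mem_singleton, h1]
  · have : {b | b ∈ ({a} : Set α) ∧ sα b = N} = ∅ := by
      ext b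
      simp only [Set.mem_singleton_iff, Set.mem_ofPred_eq, Set.mem_empty_iff_false, iff_false]
      rintro ⟨rfl, h⟩
      exact hN (h.symm.trans h0)
    rw [this, finsum_mem_empty]

/-- Meant for attaching a root: `X` counts it and `c` is its weight. Finite fibres turn each
`finsum`, which is zero by default on infinite supports, into a genuine sum. -/
theorem genFun_image (f : α → γ) (hf : Function.Injective f) (c : ℝ) (A : Set α)
    (hs : ∀ a, sγ (f a) = sα a + 1) (hw : ∀ a ∈ A, wγ (f a) = c * wα a)
    (hA : ∀ N, {a | a ∈ A ∧ sα a = N}.Finite) :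
    genFun sγ wγ (f '' A) = X * (C c * genFun sα wα A) := by
  ext N
  rcases N with _ | N
  · have : {b | b ∈ f '' A ∧ sγ b = 0} = ∅ := by
      ext b
      simp only [Set.mem_ofPred_eq, Set.mem_empty_iff_false, iff_false]
      rintro ⟨⟨a, -, rfl⟩, h⟩
      rw [hs] at h
      omega
    rw [genFun, coeff_mk, this, finsum_mem_empty, coeff_zero_X_mul]
  · have : {b | b ∈ f '' A ∧ sγ b = N + 1} = f '' {a | a ∈ A ∧ sα a = N} := by
      ext b
      constructor
      · rintro ⟨⟨a, ha, rfl⟩, h⟩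
        rw [hs] at h
        exact ⟨a, ⟨ha, by omega⟩, rfl⟩
      · rintro ⟨a, ⟨ha, h⟩, rfl⟩
        exact ⟨⟨a, ha, rfl⟩, by rw [hs, h]⟩
    rw [coeff_succ_X_mul, coeff_C_mul, genFun, coeff_mk, this, finsum_mem_image hf.injOn, genFun,
      coeff_mk, finsum_mem_eq_finite_toFinset_sum _ (hA N),
      finsum_mem_eq_finite_toFinset_sum _ (hA N), Finset.mul_sum]
    exact Finset.sum_congr rfl fun a ha => hw a ((hA N).mem_toFinset.1 ha).1

/-- The fibre of size `N` splits disjointly according to the sizes of the two components, which is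
the Cauchy product. -/
theorem genFun_image2 (f : α → β → γ) (hf : Function.Injective2 f) (A : Set α) (B : Set β)
    (hs : ∀ a b, sγ (f a b) = sα a + sβ b) (hw : ∀ a b, wγ (f a b) = wα a * wβ b)
    (hA : ∀ N, {a | a ∈ A ∧ sα a = N}.Finite) (hB : ∀ N, {b | b ∈ B ∧ sβ b = N}.Finite) :
    genFun sγ wγ (Set.image2 f A B) = genFun sα wα A * genFun sβ wβ B := by
  ext N
  simp only [coeff_mul, genFun, coeff_mk]
  have h1 : {c | c ∈ Set.image2 f A B ∧ sγ c = N} =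
      ⋃ ij ∈ (Finset.HasAntidiagonal.antidiagonal N : Set (ℕ × ℕ)), Function.uncurry f ''
        ({a | a ∈ A ∧ sα a = ij.1} ×ˢ {b | b ∈ B ∧ sβ b = ij.2}) := by
    ext c
    simp only [Set.mem_iUnion, Finset.mem_coe, Finset.HasAntidiagonal.mem_antidiagonal]
    constructor
    · rintro ⟨⟨a, ha, b, hb, rfl⟩, h⟩
      rw [hs] at h
      exact ⟨(sα a, sβ b), h, (a, b), ⟨⟨ha, rfl⟩, ⟨hb, rfl⟩⟩, rfl⟩
    · rintro ⟨⟨i, j⟩, h, ⟨a, b⟩, ⟨⟨ha, rfl⟩, ⟨hb, rfl⟩⟩, rfl⟩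
      exact ⟨⟨a, ha, b, hb, rfl⟩, by rw [Function.uncurry_apply_pair, hs]; exact h⟩
  rw [h1, finsum_mem_biUnion _ (Finset.finite_toSet _)]
  · rw [finsum_mem_coe_finset]
    refine Finset.sum_congr rfl fun ij _ => ?_
    rw [finsum_mem_image hf.uncurry.injOn, finsum_mem_eq_finite_toFinset_sum _ (hA ij.1),
      finsum_mem_eq_finite_toFinset_sum _ (hB ij.2),
      finsum_mem_eq_finite_toFinset_sum _ ((hA ij.1).prod (hB ij.2)), ← Set.Finite.toFinset_prod,
      Finset.sum_product, Finset.sum_mul_sum]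
    · exact Finset.sum_congr rfl fun a _ => Finset.sum_congr rfl fun b _ => hw a b
    · exact hA ij.1
    · exact hB ij.2
  · rintro ⟨i, j⟩ -
    exact ((hA i).prod (hB j)).image _
  · rintro ⟨i, j⟩ - ⟨i', j'⟩ - hne
    rw [Function.onFun, Set.disjoint_left]
    rintro _ ⟨⟨a, b⟩, ⟨⟨-, rfl⟩, ⟨-, rfl⟩⟩, rfl⟩ ⟨⟨a', b'⟩, ⟨⟨-, h1⟩, ⟨-, h2⟩⟩, h⟩
    obtain ⟨rfl, rfl⟩ := hf h
    exact hne (Prod.ext h1 h2)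

theorem genFun_biUnion {ι : Type*} (s : Finset ι) (A : ι → Set α)
    (hd : (s : Set ι).PairwiseDisjoint A) (hA : ∀ i, ∀ N, {a | a ∈ A i ∧ sα a = N}.Finite) :
    genFun sα wα (⋃ i ∈ s, A i) = ∑ i ∈ s, genFun sα wα (A i) := by
  ext N
  simp only [map_sum, genFun, coeff_mk]
  have : {a | a ∈ ⋃ i ∈ s, A i ∧ sα a = N} = ⋃ i ∈ (s : Set ι), {a | a ∈ A i ∧ sα a = N} := by
    ext a
    simp
    tauto
  rw [this, finsum_mem_biUnion _ s.finite_toSet fun i _ => hA i N, finsum_mem_coe_finset]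
  intro i hi j hj hij
  exact (hd hi hj hij).mono (fun _ h => h.1) (fun _ h => h.1)

end GenFun

/-! ### Generating functions of trees and forests -/

section Forests

open PowerSeries

variable (E : ℕ → ℝ) (β : ℝ)

/-- The total number of vertices of a forest. -/
def forestOrder (ts : List PlaneTree) : ℕ := (ts.map order).sum

/-- The Boltzmann weight of a tree. -/
def treeWeight (T : PlaneTree) : ℝ := Real.exp (-β * T.energy E)

/-- The Boltzmann weight of a forest. -/
def forestWeight (ts : List PlaneTree) : ℝ := (ts.map (treeWeight E β)).prod

/-- The generating function of a set of trees. -/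
def treeGF (A : Set PlaneTree) : ℝ⟦X⟧ := genFun order (treeWeight E β) A

/-- The generating function of a set of forests. -/
def forestGF (A : Set (List PlaneTree)) : ℝ⟦X⟧ := genFun forestOrder (forestWeight E β) A

/-- The forests whose trees belong to given sets. -/
def forestsIn (As : List (Set PlaneTree)) : Set (List PlaneTree) :=
  {ts | List.Forall₂ (fun t A => t ∈ A) ts As}

theorem prod_map_exp (f : PlaneTree → ℝ) (ts : List PlaneTree) :
    (ts.map fun t => Real.exp (-β * f t)).prod = Real.exp (-β * (ts.map f).sum) := by
  induction ts with
  | nil => simp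
  | cons t ts ih => rw [List.map_cons, List.prod_cons, ih, List.map_cons, List.sum_cons, mul_add,
      Real.exp_add]

theorem treeWeight_node (ts : List PlaneTree) :
    treeWeight E β (node ts) = Real.exp (-β * E ts.length) * forestWeight E β ts := by
  have : forestWeight E β ts = Real.exp (-β * (ts.map (energy E)).sum) := prod_map_exp β (energy E) ts
  rw [this, treeWeight, energy_node, mul_add, Real.exp_add]

theorem node_injective : Function.Injective node := fun _ _ h => by injection h

theorem finite_forest_fiber (A : Set (List PlaneTree)) (N : ℕ) :
    {ts | ts ∈ A ∧ forestOrder ts = N}.Finite :=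
  (finite_forests N).subset fun _ h => h.2.le

theorem finite_tree_fiber (A : Set PlaneTree) (N : ℕ) : {T | T ∈ A ∧ T.order = N}.Finite := by
  refine ((finite_forests N).image node).subset ?_
  rintro ⟨ts⟩ ⟨-, h⟩
  rw [order_node] at h
  exact ⟨ts, by simp only [Set.mem_ofPred_eq]; omega, rfl⟩

/-- The allowed set varies with the position so that `treeGF_trunc` can prescribe a different
neighborhood for each child; `allGF_eq` uses a constant list. -/
theorem forestGF_forestsIn (As : List (Set PlaneTree)) :
    forestGF E β (forestsIn As) = (As.map (treeGF E β)).prod := by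
  induction As with
  | nil =>
    have : forestsIn [] = {[]} := by
      ext ts
      simp [forestsIn]
    rw [this]
    exact genFun_singleton _ rfl rfl
  | cons A As ih =>
    have : forestsIn (A :: As) = Set.image2 List.cons A (forestsIn As) := by
      ext ts
      simp only [forestsIn, Set.mem_ofPred_eq, List.forall₂_cons_right_iff, Set.mem_image2]
      constructor
      · rintro ⟨t, us, h1, h2, rfl⟩
        exact ⟨t, h1, us, h2, rfl⟩
      · rintro ⟨t, h1, us, h2, rfl⟩
        exact ⟨t, us, h1, h2, rfl⟩
    rw [this, List.map_cons, List.prod_cons, ← ih]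
    exact genFun_image2 List.cons (fun _ _ _ _ h => by simpa using h) _ _
      (fun t ts => by simp [forestOrder]) (fun t ts => by simp [forestWeight])
      (finite_tree_fiber _) (finite_forest_fiber _)

/-- The length is fixed because the weight of the new root depends on its number of children. -/
theorem treeGF_node_image (A : Set (List PlaneTree)) (l : ℕ) (hA : ∀ ts ∈ A, ts.length = l) :
    treeGF E β (node '' A) = X * (C (Real.exp (-β * E l)) * forestGF E β A) :=
  genFun_image node node_injective _ A (fun ts => order_node ts)
    (fun ts hts => by rw [treeWeight_node, hA ts hts]) (finite_forest_fiber _)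

/-- The generating function of all trees with branching numbers at most `D`. -/
def allGF (D : ℕ) : ℝ⟦X⟧ := treeGF E β {T | T.BranchingLE D}

theorem mem_forestsIn_replicate {A : Set PlaneTree} {l : ℕ} {ts : List PlaneTree} :
    ts ∈ forestsIn (List.replicate l A) ↔ ts.length = l ∧ ∀ t ∈ ts, t ∈ A := by
  induction l generalizing ts with
  | zero =>
    simp only [forestsIn, List.replicate_zero, List.forall₂_nil_right_iff, Set.mem_ofPred_eq,
      List.length_eq_zero_iff]
    exact ⟨fun h => ⟨h, by simp [h]⟩, fun h => h.1⟩
  | succ l ih =>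
    rw [List.replicate_succ]
    rcases ts with _ | ⟨t, ts⟩
    · simp [forestsIn]
    · simp only [forestsIn, Set.mem_ofPred_eq, List.forall₂_cons] at ih ⊢
      rw [ih]
      simp
      tauto

/-- Decomposing trees at the root. -/
theorem allGF_eq (D : ℕ) : allGF E β D =
    X * ∑ l ∈ Finset.range (D + 1), C (Real.exp (-β * E l)) * allGF E β D ^ l := by
  have h : {T : PlaneTree | T.BranchingLE D} = ⋃ l ∈ Finset.range (D + 1),
      node '' forestsIn (List.replicate l {T | T.BranchingLE D}) := by
    ext ⟨ts⟩
    simp only [Set.mem_ofPred_eq, branchingLE_node, Set.mem_iUnion, Set.mem_image,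
      mem_forestsIn_replicate, Finset.mem_range]
    constructor
    · rintro ⟨h1, h2⟩
      exact ⟨ts.length, by omega, ts, ⟨rfl, h2⟩, rfl⟩
    · rintro ⟨l, hl, us, ⟨rfl, h2⟩, h⟩
      rw [← node_injective h]
      exact ⟨by omega, h2⟩
  conv_lhs => rw [allGF, h]
  rw [treeGF, genFun_biUnion, Finset.mul_sum]
  · refine Finset.sum_congr rfl fun l _ => ?_
    have := treeGF_node_image E β (forestsIn (List.replicate l {T | T.BranchingLE D})) l
      fun ts hts => (mem_forestsIn_replicate.1 hts).1
    rw [treeGF] at this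
    rw [this, forestGF_forestsIn, List.map_replicate, List.prod_replicate]
    rfl
  · intro l _ l' _ hl
    rw [Function.onFun, Set.disjoint_left]
    rintro _ ⟨ts, hts, rfl⟩ ⟨us, hus, h⟩
    obtain rfl := node_injective h
    exact hl ((mem_forestsIn_replicate.1 hts).1.symm.trans (mem_forestsIn_replicate.1 hus).1)
  · exact fun l => finite_tree_fiber _

/-- The trees with a given neighborhood of the root: independent trees grow from the vertices of
height `n`. -/
theorem treeGF_trunc (D n : ℕ) (τ : PlaneTree) (hτ : τ.height ≤ n) (hD : τ.BranchingLE D) :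
    treeGF E β {T | T.BranchingLE D ∧ PlaneTree.trunc n T = τ} =
      C (Real.exp (-β * τ.energyBelow E n)) * X ^ τ.numBelow n * allGF E β D ^ τ.numAt n := by
  induction n generalizing τ with
  | zero =>
    obtain ⟨ts⟩ := τ
    obtain rfl := height_node_le_zero.1 hτ
    rw [numAt_zero, numBelow_zero, energyBelow_zero]
    simp [PlaneTree.trunc, allGF]
  | succ n ih =>
    obtain ⟨ts⟩ := τ
    rw [height_node_le_succ] at hτ
    rw [branchingLE_node] at hD
    set A : PlaneTree → Set PlaneTree := fun t => {T | T.BranchingLE D ∧ PlaneTree.trunc n T = t} with hA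
    have hmem : ∀ us, us ∈ forestsIn (ts.map A) ↔
        (∀ u ∈ us, u.BranchingLE D) ∧ us.map (PlaneTree.trunc n) = ts := by
      intro us
      simp only [forestsIn, Set.mem_ofPred_eq, List.forall₂_map_right_iff, hA]
      clear hτ hD
      induction us generalizing ts with
      | nil => rcases ts with _ | ⟨t, ts⟩ <;> simp
      | cons u us ih' =>
        rcases ts with _ | ⟨t, ts⟩
        · simp
        · simp [ih']
          tauto
    have h : {T : PlaneTree | T.BranchingLE D ∧ PlaneTree.trunc (n + 1) T = node ts} =
        node '' forestsIn (ts.map A) := by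
      ext ⟨us⟩
      simp only [Set.mem_ofPred_eq, branchingLE_node, PlaneTree.trunc, Set.mem_image, hmem]
      constructor
      · rintro ⟨⟨-, h1⟩, h2⟩
        exact ⟨us, ⟨h1, node_injective h2⟩, rfl⟩
      · rintro ⟨vs, ⟨h1, h2⟩, h⟩
        obtain rfl := node_injective h
        refine ⟨⟨?_, h1⟩, by rw [h2]⟩
        rw [← h2, List.length_map] at hD
        exact hD.1
    rw [h, treeGF_node_image E β _ ts.length, forestGF_forestsIn, numAt_succ_node,
      numBelow_succ_node, energyBelow_succ_node, List.map_map, mul_add, Real.exp_add]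
    · have : (ts.map (treeGF E β ∘ A)).prod =
          C (Real.exp (-β * (ts.map (energyBelow E n)).sum)) * X ^ (ts.map (numBelow n)).sum *
            allGF E β D ^ (ts.map (numAt n)).sum := by
        -- Inducting over lists with members in `ts` keeps the height and branching bounds, and
        -- hence `ih`, available.
        have key : ∀ us : List PlaneTree, (∀ t ∈ us, t ∈ ts) → (us.map (treeGF E β ∘ A)).prod =
          C (Real.exp (-β * (us.map (energyBelow E n)).sum)) * X ^ (us.map (numBelow n)).sum *
            allGF E β D ^ (us.map (numAt n)).sum := by
          intro us hus
          induction us with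
          | nil => simp
          | cons u us ih' =>
            have hu := hus u (by simp)
            simp only [List.map_cons, List.prod_cons, List.sum_cons, mul_add, Real.exp_add,
              map_mul, pow_add]
            rw [ih' fun t ht => hus t (by simp [ht]), Function.comp_apply,
              ih u (hτ u hu) (hD.2 u hu)]
            ring
        exact key ts fun _ h => h
      rw [this, map_mul]
      ring
    · intro us hus
      rw [← ((hmem us).1 hus).2, List.length_map]

theorem coeff_treeGF (A : Set PlaneTree) (D N : ℕ) [DecidablePred (· ∈ A)] :
    coeff N (treeGF E β {T | T.BranchingLE D ∧ T ∈ A}) =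
      ∑ T ∈ trees D N with T ∈ A, treeWeight E β T := by
  rw [treeGF, genFun, coeff_mk, finsum_mem_eq_finite_toFinset_sum _ (finite_tree_fiber _ N)]
  refine Finset.sum_congr ?_ fun _ _ => rfl
  ext T
  simp [mem_trees]
  tauto

end Forests

/-! ### A local limit theorem -/

section LocalLimit

variable (p : ℕ → ℝ) (d : ℕ)

/-- The characteristic function of the step `i - 1`, taken with probability `p i`. -/
def stepCharFun (t : ℝ) : ℂ :=
  ∑ i ∈ Finset.range d, (p i : ℂ) * Complex.exp (((i : ℝ) - 1 : ℝ) * t * Complex.I)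

theorem continuous_stepCharFun : Continuous (stepCharFun p d) := by
  unfold stepCharFun
  fun_prop

variable {p d}

/-- The steps `-1` and `0` alone give the decay; the others are bounded by the triangle inequality.
With `s = p 0 + p 1`, the two terms have squared modulus `s² - 2 p 0 p 1 (1 - cos t)`. Since `cos t
≤ 1 - 2t²/π²`, the constant `c` is chosen so that this is at most `s² - 2 s c t² ≤ (s - c t²)²`. -/
theorem norm_stepCharFun_le (hp : ∀ i, 0 ≤ p i) (hp0 : 0 < p 0) (hp1 : 0 < p 1) (hd : 2 ≤ d)
    (hsum : ∑ i ∈ Finset.range d, p i = 1) {t : ℝ} (ht : |t| ≤ Real.pi) :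
    ‖stepCharFun p d t‖ ≤ Real.exp (-(2 * p 0 * p 1 / (Real.pi ^ 2 * (p 0 + p 1))) * t ^ 2) := by
  obtain ⟨e, rfl⟩ := Nat.exists_eq_add_of_le' hd
  set s := p 0 + p 1 with hs
  have hs0 : 0 < s := by positivity
  set c := 2 * p 0 * p 1 / (Real.pi ^ 2 * s) with hc
  have hpi := Real.pi_pos
  rw [Finset.sum_range_succ', Finset.sum_range_succ'] at hsum
  have hcos : Real.cos t ≤ 1 - 2 / Real.pi ^ 2 * t ^ 2 := Real.cos_le_one_sub_mul_cos_sq ht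
  have h2 : ‖(p 0 : ℂ) * Complex.exp (((0 : ℝ) - 1 : ℝ) * t * Complex.I) + p 1‖ ≤ s - c * t ^ 2 := by
    have hsq : t ^ 2 ≤ Real.pi ^ 2 := by
      rw [← sq_abs]; gcongr
    have hcs : c * Real.pi ^ 2 * s = 2 * p 0 * p 1 := by rw [hc]; field_simp
    have hnn : 0 ≤ s - c * t ^ 2 := by
      have h3 : c * t ^ 2 ≤ c * Real.pi ^ 2 := by
        have : 0 ≤ c := by positivity
        gcongr
      nlinarith [sq_nonneg (p 0 - p 1)]
    rw [← sq_le_sq₀ (norm_nonneg _) hnn, Complex.sq_norm, Complex.normSq_apply]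
    have e1 : Complex.exp (((0 : ℝ) - 1 : ℝ) * t * Complex.I) =
        (Real.cos t : ℂ) - Real.sin t * Complex.I := by
      rw [zero_sub, show ((-1 : ℝ) : ℂ) * t * Complex.I = -t * Complex.I by push_cast; ring,
        Complex.exp_mul_I, Complex.cos_neg, Complex.sin_neg]
      push_cast
      ring
    rw [e1]
    simp only [Complex.add_re, Complex.mul_re, Complex.sub_re, Complex.ofReal_re, Complex.ofReal_im,
      Complex.I_re, Complex.I_im, Complex.add_im, Complex.mul_im, Complex.sub_im]
    have hsc := Real.sin_sq_add_cos_sq t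
    have e2 : (p 0 * Real.cos t + p 1) * (p 0 * Real.cos t + p 1) + p 0 * Real.sin t * (p 0 * Real.sin t)
        = s ^ 2 - 2 * p 0 * p 1 * (1 - Real.cos t) := by
      rw [hs]; linear_combination p 0 ^ 2 * hsc
    have e3 : 2 * p 0 * p 1 * (2 / Real.pi ^ 2 * t ^ 2) = 2 * s * (c * t ^ 2) := by
      rw [← hcs]; field_simp
    have e4 : 2 * p 0 * p 1 * (2 / Real.pi ^ 2 * t ^ 2) ≤ 2 * p 0 * p 1 * (1 - Real.cos t) := by
      gcongr
      linarith
    calc _ = (p 0 * Real.cos t + p 1) * (p 0 * Real.cos t + p 1) +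
          p 0 * Real.sin t * (p 0 * Real.sin t) := by ring
      _ ≤ _ := by rw [e2]; nlinarith [sq_nonneg (c * t ^ 2)]
  have hb : ∀ x y : ℝ, ‖Complex.exp ((x : ℂ) * y * Complex.I)‖ = 1 := fun x y => by
    rw [← Complex.ofReal_mul, Complex.norm_exp_ofReal_mul_I]
  calc ‖stepCharFun p (e + 2) t‖
      ≤ ∑ i ∈ Finset.range e, p (i + 1 + 1) + (s - c * t ^ 2) := by
        rw [stepCharFun, Finset.sum_range_succ', Finset.sum_range_succ', add_assoc]
        refine (norm_add_le _ _).trans (add_le_add ?_ ?_)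
        · refine (norm_sum_le _ _).trans (Finset.sum_le_sum fun i _ => ?_)
          rw [norm_mul, hb, Complex.norm_real, Real.norm_of_nonneg (hp _), mul_one]
        · rw [add_comm]
          simpa using h2
    _ = 1 - c * t ^ 2 := by rw [hs]; linear_combination hsum
    _ ≤ Real.exp (-c * t ^ 2) := by
        have := Real.add_one_le_exp (-c * t ^ 2)
        linarith

/-- Second-order Taylor expansion at scale `1/√n`: the cubic remainder times `n` is `O(1/√n)`. -/
theorem tendsto_mul_exp_sub_one_sub (a : ℝ) :
    Tendsto (fun n : ℕ => (n : ℂ) * (Complex.exp (((a / √n : ℝ) : ℂ) * Complex.I) - 1 -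
      ((a / √n : ℝ) : ℂ) * Complex.I)) atTop (𝓝 (-(a ^ 2 / 2 : ℝ))) := by
  have hs : Tendsto (fun n : ℕ => √(n : ℝ)) atTop atTop :=
    Real.tendsto_sqrt_atTop.comp tendsto_natCast_atTop_atTop
  rw [tendsto_iff_norm_sub_tendsto_zero]
  have hlim : Tendsto (fun n : ℕ => |a| ^ 3 * Real.exp |a| / √(n : ℝ)) atTop (𝓝 0) :=
    hs.const_div_atTop _
  refine squeeze_zero' (Eventually.of_forall fun _ => norm_nonneg _) ?_ hlim
  filter_upwards [eventually_ge_atTop 1] with n hn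
  have hn1 : (1 : ℝ) ≤ √n := by
    rw [Real.one_le_sqrt]; exact_mod_cast hn
  have hn0 : (0 : ℝ) < √n := by linarith
  have hnn : √(n : ℝ) ^ 2 = n := Real.sq_sqrt (by positivity)
  set x : ℂ := ((a / √n : ℝ) : ℂ) * Complex.I with hx
  have hxn : ‖x‖ = |a| / √n := by
    rw [hx, norm_mul, Complex.norm_I, mul_one, Complex.norm_real, Real.norm_eq_abs, abs_div,
      abs_of_pos hn0]
  have hxx : (n : ℂ) * (x ^ 2 / 2) = -(a ^ 2 / 2 : ℝ) := by
    rw [hx, mul_pow, Complex.I_sq, ← Complex.ofReal_pow, div_pow, hnn]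
    have : (n : ℂ) ≠ 0 := by exact_mod_cast (by omega : n ≠ 0)
    push_cast
    field_simp
  have hb := Complex.norm_exp_sub_sum_le_norm_mul_exp x 3
  have hsum : ∑ m ∈ Finset.range 3, x ^ m / (m.factorial : ℂ) = 1 + x + x ^ 2 / 2 := by
    simp [Finset.sum_range_succ, Nat.factorial]
  rw [hsum] at hb
  rw [← hxx, show (n : ℂ) * (Complex.exp x - 1 - x) - n * (x ^ 2 / 2) =
    n * (Complex.exp x - (1 + x + x ^ 2 / 2)) by ring, norm_mul, Complex.norm_natCast]
  calc (n : ℝ) * ‖Complex.exp x - (1 + x + x ^ 2 / 2)‖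
      ≤ n * ((|a| / √n) ^ 3 * Real.exp |a|) := by
        rw [← hxn]
        gcongr
        refine hb.trans ?_
        gcongr
        rw [hxn]
        exact div_le_self (abs_nonneg a) hn1
    _ = _ := by
        nth_rewrite 1 [← hnn]
        field_simp

theorem tendsto_stepCharFun_pow (hsum : ∑ i ∈ Finset.range d, p i = 1)
    (hmean : ∑ i ∈ Finset.range d, i * p i = 1) (s : ℝ) :
    Tendsto (fun n : ℕ => stepCharFun p d (s / √n) ^ n) atTop
      (𝓝 (Real.exp (-((∑ i ∈ Finset.range d, p i * ((i : ℝ) - 1) ^ 2) / 2) * s ^ 2) : ℝ)) := by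
  have h := tendsto_finsetSum (Finset.range d) fun i _ =>
    (tendsto_mul_exp_sub_one_sub (((i : ℝ) - 1) * s)).const_mul (p i : ℂ)
  have hc1 : ∑ i ∈ Finset.range d, (p i : ℂ) = 1 := by exact_mod_cast hsum
  have hc2 : ∑ i ∈ Finset.range d, (i : ℂ) * p i = 1 := by exact_mod_cast hmean
  have h' : Tendsto (fun n : ℕ => (n : ℂ) * (stepCharFun p d (s / √n) - 1)) atTop
      (𝓝 ((-((∑ i ∈ Finset.range d, p i * ((i : ℝ) - 1) ^ 2) / 2) * s ^ 2 : ℝ) : ℂ)) := by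
    convert h using 2 with n
    · have hz : ∑ i ∈ Finset.range d, (p i : ℂ) * (1 + ((((i : ℝ) - 1) * s / √n : ℝ) : ℂ) * Complex.I)
          = 1 := by
        have : ∀ i : ℕ, (p i : ℂ) * (1 + ((((i : ℝ) - 1) * s / √n : ℝ) : ℂ) * Complex.I) =
            p i + (i * p i - p i) * (((s / √n : ℝ) : ℂ) * Complex.I) := by
          intro i; push_cast; ring
        simp only [this, Finset.sum_add_distrib, ← Finset.sum_mul, Finset.sum_sub_distrib, hc1, hc2]
        ring
      nth_rewrite 1 [← hz]
      rw [stepCharFun, ← Finset.sum_sub_distrib, Finset.mul_sum]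
      refine Finset.sum_congr rfl fun i _ => ?_
      have : ((((i : ℝ) - 1) * s / √n : ℝ) : ℂ) * Complex.I =
          (((i : ℝ) - 1 : ℝ) : ℂ) * ((s / √n : ℝ) : ℂ) * Complex.I := by push_cast; ring
      rw [this]
      ring
    · push_cast
      rw [Finset.sum_div, neg_mul, Finset.sum_mul, ← Finset.sum_neg_distrib]
      exact Finset.sum_congr rfl fun i _ => by ring
  have := Complex.tendsto_one_add_pow_exp_of_tendsto h'
  rw [Complex.ofReal_exp]
  simpa using this

/-- Fourier inversion on the unit circle, by orthogonality of the characters. -/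
theorem coeff_eq_integral (Q : Polynomial ℝ) (N : ℕ) :
    ((2 * Real.pi * Q.coeff N : ℝ) : ℂ) = ∫ t in (-Real.pi)..Real.pi,
      Polynomial.aeval (Complex.exp (t * Complex.I)) Q * Complex.exp (-N * (t * Complex.I)) := by
  have hint : ∀ m : ℕ, ∫ t in (-Real.pi)..Real.pi,
      Complex.exp (t * Complex.I) ^ m * Complex.exp (-N * (t * Complex.I)) =
        if m = N then 2 * (Real.pi : ℂ) else 0 := by
    intro m
    have e : ∀ t : ℝ, Complex.exp (t * Complex.I) ^ m * Complex.exp (-N * (t * Complex.I)) =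
        Complex.exp ((((m : ℂ) - N) * Complex.I) * t) := by
      intro t
      rw [← Complex.exp_nat_mul, ← Complex.exp_add]
      congr 1
      ring
    simp only [e]
    split_ifs with h
    · subst h
      simp
      ring
    · have hne : ((m : ℂ) - N) * Complex.I ≠ 0 :=
        mul_ne_zero (sub_ne_zero.2 (by exact_mod_cast h)) Complex.I_ne_zero
      rw [integral_exp_mul_complex hne, div_eq_zero_iff]
      left
      rw [sub_eq_zero, Complex.exp_eq_exp_iff_exists_int]
      refine ⟨m - N, ?_⟩
      push_cast
      ring
  simp only [Polynomial.aeval_eq_sum_range, Finset.sum_mul]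
  rw [intervalIntegral.integral_finsetSum]
  · have : ∀ m : ℕ, ∫ t in (-Real.pi)..Real.pi, Q.coeff m • Complex.exp (t * Complex.I) ^ m *
        Complex.exp (-N * (t * Complex.I)) = Q.coeff m * if m = N then 2 * (Real.pi : ℂ) else 0 := by
      intro m
      simp only [Complex.real_smul, mul_assoc]
      rw [intervalIntegral.integral_const_mul, hint]
    simp only [this, mul_ite, mul_zero]
    rw [Finset.sum_ite_eq']
    split_ifs with h
    · push_cast; ring
    · rw [Finset.mem_range, not_lt] at h
      rw [Polynomial.coeff_eq_zero_of_natDegree_lt (by omega)]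
      simp
  · intro m _
    apply Continuous.intervalIntegrable
    fun_prop

/-- The local limit theorem for the sum of `N` offspring numbers. -/
theorem local_limit (hp : ∀ i, 0 ≤ p i) (hp0 : 0 < p 0) (hp1 : 0 < p 1) (hd : 2 ≤ d)
    (hsum : ∑ i ∈ Finset.range d, p i = 1) (hmean : ∑ i ∈ Finset.range d, i * p i = 1) :
    ∃ c : ℝ, 0 < c ∧ ∀ k : ℕ, Tendsto (fun N : ℕ => √N * (Polynomial.X ^ k *
      (∑ i ∈ Finset.range d, Polynomial.C (p i) * Polynomial.X ^ i) ^ N).coeff N)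
      atTop (𝓝 c) := by
  set v := (∑ i ∈ Finset.range d, p i * ((i : ℝ) - 1) ^ 2) / 2 with hv
  have hv0 : 0 < v := by
    have h0 : p 0 * (((0 : ℕ) : ℝ) - 1) ^ 2 ≤ ∑ i ∈ Finset.range d, p i * ((i : ℝ) - 1) ^ 2 :=
      Finset.single_le_sum (f := fun i : ℕ => p i * ((i : ℝ) - 1) ^ 2)
        (fun i _ => mul_nonneg (hp i) (sq_nonneg _)) (Finset.mem_range.2 (by omega))
    norm_num at h0
    rw [hv]
    linarith
  set b := 2 * p 0 * p 1 / (Real.pi ^ 2 * (p 0 + p 1)) with hb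
  have hb0 : 0 < b := by positivity
  have hpi := Real.pi_pos
  -- The Gaussian integral of `exp (-v s²)` divided by the period. With `v` half the variance it
  -- equals `1/√(2π · variance)`.
  refine ⟨√(Real.pi / v) / (2 * Real.pi), by positivity, fun k => ?_⟩
  set φ : Polynomial ℝ := ∑ i ∈ Finset.range d, Polynomial.C (p i) * Polynomial.X ^ i with hφ
  -- The inversion integrand after `t = s/√N`, extended by zero to the whole line for dominated
  -- convergence. The factor with `k` tends to `1`, which is why the limit does not depend on `k`.
  set F : ℕ → ℝ → ℂ := fun N => (Set.Ioc (-Real.pi * √N) (Real.pi * √N)).indicator fun s =>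
    stepCharFun p d (s / √N) ^ N * Complex.exp (k * ((s / √N : ℝ) * Complex.I)) with hF
  have hlim : Tendsto (fun N => ∫ s, F N s) atTop (𝓝 (∫ s, (Real.exp (-v * s ^ 2) : ℂ))) := by
    refine tendsto_integral_of_dominated_convergence (fun s => Real.exp (-b * s ^ 2)) ?_
      (integrable_exp_neg_mul_sq hb0) ?_ ?_
    · intro N
      have := continuous_stepCharFun p d
      exact (Continuous.aestronglyMeasurable (by fun_prop)).indicator measurableSet_Ioc
    · intro N
      refine Eventually.of_forall fun s => ?_
      by_cases hs : s ∈ Set.Ioc (-Real.pi * √N) (Real.pi * √N)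
      · rw [hF]
        simp only
        rw [Set.indicator_of_mem hs, norm_mul, norm_pow]
        -- At `N = 0` the window is empty.
        have hN : 0 < √(N : ℝ) := by
          rcases (Real.sqrt_nonneg (N : ℝ)).eq_or_lt with h | h
          · rw [← h] at hs; simp at hs
          · exact h
        have he : ‖Complex.exp (k * ((s / √N : ℝ) * Complex.I))‖ = 1 := by
          rw [← mul_assoc, ← Complex.ofReal_natCast, ← Complex.ofReal_mul,
            Complex.norm_exp_ofReal_mul_I]
        have habs : |s / √N| ≤ Real.pi := by
          rw [abs_le]
          refine ⟨?_, ?_⟩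
          · rw [le_div_iff₀ hN]; exact hs.1.le
          · rw [div_le_iff₀ hN]; exact hs.2
        rw [he, mul_one]
        calc _ ≤ Real.exp (-b * (s / √N) ^ 2) ^ N := by
              gcongr
              exact norm_stepCharFun_le hp hp0 hp1 hd hsum habs
          _ = _ := by
              rw [← Real.exp_nat_mul, div_pow, Real.sq_sqrt (by positivity)]
              congr 1
              have : (N : ℝ) ≠ 0 := (Real.sqrt_pos.1 hN).ne'
              field_simp
      · rw [hF]
        simp only
        rw [Set.indicator_of_notMem hs, norm_zero]
        positivity
    · refine Eventually.of_forall fun s => ?_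
      have hsq : Tendsto (fun n : ℕ => √(n : ℝ)) atTop atTop :=
        Real.tendsto_sqrt_atTop.comp tendsto_natCast_atTop_atTop
      have h1 : Tendsto (fun N : ℕ => stepCharFun p d (s / √N) ^ N *
          Complex.exp (k * ((s / √N : ℝ) * Complex.I))) atTop
          (𝓝 ((Real.exp (-v * s ^ 2) : ℝ) : ℂ)) := by
        have h0 : Tendsto (fun N : ℕ => ((s / √N : ℝ) : ℂ)) atTop (𝓝 ((0 : ℝ) : ℂ)) :=
          (Complex.continuous_ofReal.tendsto 0).comp (hsq.const_div_atTop s)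
        have h2 := (Complex.continuous_exp.tendsto _).comp
          ((h0.mul_const Complex.I).const_mul (k : ℂ))
        have := (tendsto_stepCharFun_pow hsum hmean s).mul h2
        simpa [← hv] using this
      refine h1.congr' ?_
      have h3 : ∀ᶠ N : ℕ in atTop, |s| / Real.pi < √(N : ℝ) := hsq.eventually_gt_atTop _
      filter_upwards [h3] with N hN
      rw [div_lt_iff₀ hpi] at hN
      have := abs_lt.1 hN
      rw [hF]
      simp only
      rw [Set.indicator_of_mem]
      constructor <;> nlinarith
  have hgauss : ∫ s : ℝ, ((Real.exp (-v * s ^ 2) : ℝ) : ℂ) = ((√(Real.pi / v) : ℝ) : ℂ) := by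
    rw [integral_complex_ofReal, integral_gaussian]
  rw [hgauss] at hlim
  have hre := (Complex.continuous_re.tendsto _).comp hlim
  have := hre.div_const (2 * Real.pi)
  rw [Complex.ofReal_re] at this
  refine this.congr' ?_
  filter_upwards [eventually_ge_atTop 1] with N hN
  have hN0 : 0 < √(N : ℝ) := Real.sqrt_pos.2 (by exact_mod_cast hN)
  have key : ∫ s, F N s = ((√N * (2 * Real.pi * (Polynomial.X ^ k * φ ^ N).coeff N) : ℝ) : ℂ) := by
    rw [hF]
    simp only
    rw [integral_indicator measurableSet_Ioc,
      ← intervalIntegral.integral_of_le (by nlinarith),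
      intervalIntegral.integral_comp_div
        (fun t : ℝ => stepCharFun p d t ^ N * Complex.exp (k * (t * Complex.I))) hN0.ne',
      mul_div_assoc, mul_div_assoc, div_self hN0.ne', mul_one, mul_one, Complex.ofReal_mul,
      coeff_eq_integral, Complex.real_smul]
    congr 1
    refine intervalIntegral.integral_congr fun t _ => ?_
    simp only [map_mul, map_pow, Polynomial.aeval_X]
    -- Centring the steps at `i - 1` extracts a factor `exp (it)`, whose `N`th power cancels the
    -- `exp (-iNt)` of the inversion formula.
    have e : Polynomial.aeval (Complex.exp (t * Complex.I)) φ =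
        stepCharFun p d t * Complex.exp (t * Complex.I) := by
      rw [hφ, stepCharFun, map_sum, Finset.sum_mul]
      refine Finset.sum_congr rfl fun i _ => ?_
      rw [map_mul, map_pow, Polynomial.aeval_X, Polynomial.aeval_C, mul_assoc, ← Complex.exp_add,
        ← Complex.exp_nat_mul]
      congr 2
      push_cast
      ring
    have e' : Complex.exp (N * (t * Complex.I)) * Complex.exp (-N * (t * Complex.I)) = 1 := by
      rw [← Complex.exp_add, neg_mul, add_neg_cancel, Complex.exp_zero]
    rw [e, mul_pow, ← Complex.exp_nat_mul, ← Complex.exp_nat_mul]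
    linear_combination -(stepCharFun p d t ^ N * Complex.exp (k * (t * Complex.I))) * e'
  rw [Function.comp_apply, key, Complex.ofReal_re]
  field_simp

end LocalLimit

open PlaneTree

/-! ### Ratio limits -/

section RatioLimit

open PowerSeries

variable {w : ℕ → ℝ} {d : ℕ} {ρ c₀ : ℝ} {T : ℝ⟦X⟧}

/-- Exponential tilting: `c₀ φ(ρx)` generates the mean-one law, so `otter_dwass` expresses the
coefficient through the local limit theorem. The factor `ρ^k` is left over because `X^k` is rescaled
too. -/
theorem tendsto_mul_coeff_pow (hw : ∀ i, 0 < w i) (hd : 2 ≤ d) (hρ : 0 < ρ) (hC : 0 < c₀)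
    (hsum : ∑ i ∈ Finset.range d, c₀ * w i * ρ ^ i = 1)
    (hmean : ∑ i ∈ Finset.range d, i * (c₀ * w i * ρ ^ i) = 1)
    (hT : T = X * ∑ i ∈ Finset.range d, C (w i) * T ^ i) :
    ∃ c : ℝ, 0 < c ∧ ∀ k : ℕ, Tendsto
      (fun N : ℕ => √N * N * (c₀ * ρ) ^ N * coeff N (T ^ k)) atTop (𝓝 (k * ρ ^ k * c)) := by
  obtain ⟨c, hc, h⟩ := local_limit (p := fun i => c₀ * w i * ρ ^ i) (d := d)
    (fun i => by have := hw i; positivity) (by have := hw 0; positivity)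
    (by have := hw 1; positivity) hd hsum hmean
  refine ⟨c, hc, fun k => ?_⟩
  refine ((h k).const_mul (k * ρ ^ k : ℝ)).congr fun N => ?_
  set φ : ℝ⟦X⟧ := ∑ i ∈ Finset.range d, C (w i) * X ^ i with hφ
  have hod := otter_dwass w d φ T hφ hT N k
  have e1 : (c₀ * ρ) ^ N * coeff N (X ^ k * φ ^ N) = ρ ^ k * (Polynomial.X ^ k *
      (∑ i ∈ Finset.range d, Polynomial.C (c₀ * w i * ρ ^ i) * Polynomial.X ^ i) ^ N).coeff N := by
    rw [← Polynomial.coeff_coe, mul_pow, mul_assoc, ← coeff_rescale, ← coeff_C_mul, ← coeff_C_mul]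
    congr 1
    have : ((∑ i ∈ Finset.range d, Polynomial.C (c₀ * w i * ρ ^ i) * Polynomial.X ^ i :
        Polynomial ℝ) : ℝ⟦X⟧) = C c₀ * rescale ρ φ := by
      rw [hφ, map_sum, Finset.mul_sum, ← Polynomial.coeToPowerSeries.ringHom_apply, map_sum]
      refine Finset.sum_congr rfl fun i _ => ?_
      have hresc : rescale ρ (C (w i)) = C (w i) := by
        ext n
        rw [coeff_rescale, coeff_C]
        split_ifs with h <;> simp [h]
      simp [rescale_X, mul_pow, hresc]
      ring
    rw [Polynomial.coe_mul, Polynomial.coe_pow, Polynomial.coe_pow, Polynomial.coe_X, this, map_mul,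
      map_pow, map_pow, rescale_X, mul_pow, mul_pow, map_pow, map_pow]
    ring
  linear_combination (-√N * (c₀ * ρ) ^ N) * hod - k * √N * e1

theorem tendsto_coeff_ratio (hw : ∀ i, 0 < w i) (hd : 2 ≤ d) (hρ : 0 < ρ) (hC : 0 < c₀)
    (hsum : ∑ i ∈ Finset.range d, c₀ * w i * ρ ^ i = 1)
    (hmean : ∑ i ∈ Finset.range d, i * (c₀ * w i * ρ ^ i) = 1)
    (hT : T = X * ∑ i ∈ Finset.range d, C (w i) * T ^ i) (m k : ℕ) :
    Tendsto (fun N : ℕ => coeff N (X ^ m * T ^ k) / coeff N T) atTop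
      (𝓝 (k * ρ ^ k / ρ * (c₀ * ρ) ^ m)) := by
  obtain ⟨c, hc, h⟩ := tendsto_mul_coeff_pow hw hd hρ hC hsum hmean hT
  -- After the shift, the coefficient of `X^m T^k` at `N + m` is that of `T^k` at `N`. Comparison
  -- with `T` at `N + m` then leaves `(c₀ρ)^m`.
  rw [← tendsto_add_atTop_iff_nat m]
  have h1 := (h 1).comp (tendsto_add_atTop_nat m)
  have hr : Tendsto (fun N : ℕ => ((N + m : ℕ) : ℝ) / N) atTop (𝓝 1) := by
    have : Tendsto (fun N : ℕ => 1 + (m : ℝ) / N) atTop (𝓝 (1 + 0)) :=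
      (tendsto_const_div_atTop_nhds_zero_nat (m : ℝ)).const_add 1
    rw [add_zero] at this
    refine this.congr' ?_
    filter_upwards [eventually_gt_atTop 0] with N hN
    have : (N : ℝ) ≠ 0 := by positivity
    push_cast
    field_simp
  have hr' := (Real.continuous_sqrt.tendsto _).comp hr
  rw [Real.sqrt_one] at hr'
  have h2 := ((((h k).div h1 (by positivity)).mul hr).mul hr').mul_const ((c₀ * ρ) ^ m)
  have e : k * ρ ^ k * c / (((1 : ℕ) : ℝ) * ρ ^ 1 * c) * 1 * 1 * (c₀ * ρ) ^ m =
      k * ρ ^ k / ρ * (c₀ * ρ) ^ m := by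
    field_simp
    simp
  rw [e] at h2
  refine h2.congr' ?_
  filter_upwards [eventually_gt_atTop 0] with N hN
  have hN0 : (0 : ℝ) < N := by exact_mod_cast hN
  have hNm : (0 : ℝ) < ((N + m : ℕ) : ℝ) := by exact_mod_cast (by omega : 0 < N + m)
  simp only [Function.comp_apply, pow_one, Pi.div_apply]
  rw [coeff_X_pow_mul, Real.sqrt_div hNm.le, pow_add (c₀ * ρ)]
  have := Real.sqrt_pos.2 hN0
  have := Real.sqrt_pos.2 hNm
  field_simp

end RatioLimit

/-! ### The variational problem -/

section Variational

/-- The difference `g(r) = ∑ (i - 1) w i r^i` has only its constant term negative and a positive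
quadratic term, so it increases strictly on `[0, ∞)` from `-w 0`. -/
theorem exists_unique_critical {w : ℕ → ℝ} (hw : ∀ i, 0 < w i) {D : ℕ} (hD : 2 ≤ D) :
    ∃ ρ : ℝ, 0 < ρ ∧ ∀ r : ℝ, 0 < r → (∑ i ∈ Finset.range (D + 1), w i * r ^ i =
      ∑ i ∈ Finset.range (D + 1), i * w i * r ^ i ↔ r = ρ) := by
  set g : ℝ → ℝ := fun r => ∑ i ∈ Finset.range (D + 1), ((i : ℝ) - 1) * w i * r ^ i with hg
  have hgr : ∀ r, ∑ i ∈ Finset.range (D + 1), w i * r ^ i =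
      ∑ i ∈ Finset.range (D + 1), i * w i * r ^ i ↔ g r = 0 := by
    intro r
    have : g r = ∑ i ∈ Finset.range (D + 1), i * w i * r ^ i -
        ∑ i ∈ Finset.range (D + 1), w i * r ^ i := by
      rw [hg, ← Finset.sum_sub_distrib]
      exact Finset.sum_congr rfl fun i _ => by ring
    rw [this, sub_eq_zero, eq_comm]
  have hmono : StrictMonoOn g (Set.Ici 0) := by
    intro a ha b hb hab
    have ha' : 0 ≤ a := ha
    refine Finset.sum_lt_sum (fun i _ => ?_) ⟨2, Finset.mem_range.2 (by omega), ?_⟩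
    · rcases i with _ | i
      · simp
      · have := (hw (i + 1)).le
        push_cast
        rw [add_sub_cancel_right]
        gcongr
    · have := hw 2
      have : a ^ 2 < b ^ 2 := by gcongr
      push_cast
      nlinarith
  have hcont : Continuous g := by fun_prop
  have hg0 : g 0 < 0 := by
    simp only [hg, Finset.sum_range_succ']
    simp [hw 0]
  -- Chosen so that `R ≥ 1` and `w 2 R² ≥ w 2 R = w 2 + w 0 > w 0`; the quadratic term alone beats
  -- the constant one.
  set R := 1 + w 0 / w 2 with hR
  have h0 := hw 0
  have h2 := hw 2
  have hR1 : 1 ≤ R := by rw [hR]; have := div_pos h0 h2; linarith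
  have hgR : 0 < g R := by
    obtain ⟨e, rfl⟩ := Nat.exists_eq_add_of_le' hD
    simp only [hg]
    rw [Finset.sum_range_succ', Finset.sum_range_succ', Finset.sum_range_succ']
    have h3 : 0 ≤ ∑ k ∈ Finset.range e, (((k + 1 + 1 + 1 : ℕ) : ℝ) - 1) * w (k + 1 + 1 + 1) *
        R ^ (k + 1 + 1 + 1) := by
      refine Finset.sum_nonneg fun i _ => ?_
      have := (hw (i + 1 + 1 + 1)).le
      push_cast
      rw [add_sub_cancel_right]
      positivity
    have h4 : w 2 * R = w 2 + w 0 := by rw [hR]; field_simp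
    push_cast
    norm_num at h3 ⊢
    nlinarith
  obtain ⟨ρ, hρ, hρ0⟩ := intermediate_value_Ioo (by linarith : (0 : ℝ) ≤ R) hcont.continuousOn
    (show (0 : ℝ) ∈ Set.Ioo (g 0) (g R) from ⟨hg0, hgR⟩)
  refine ⟨ρ, hρ.1, fun r hr => ?_⟩
  rw [hgr, ← hρ0]
  exact hmono.injOn.eq_iff hr.le hρ.1.le

/-- The termwise Gibbs inequality, from `log x ≤ x - 1` at `x = p/q`; for `q = 0` both logarithmic
terms vanish. -/
theorem mul_log_sub_mul_log_ge {q p : ℝ} (hq : 0 ≤ q) (hp : 0 < p) :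
    q - p ≤ q * Real.log q - q * Real.log p ∧
      (q ≠ p → q - p < q * Real.log q - q * Real.log p) := by
  rcases hq.eq_or_lt with rfl | hq
  · simp [hp.le, hp]
  · have h : ∀ x, x = q * Real.log q - q * Real.log p → x = - (q * Real.log (p / q)) := by
      rintro x rfl
      rw [Real.log_div hp.ne' hq.ne']; ring
    rw [h _ rfl]
    have e : q - p = - (q * (p / q - 1)) := by field_simp; ring
    rw [e]
    have hpq := div_pos hp hq
    refine ⟨?_, fun hne => ?_⟩
    · have := Real.log_le_sub_one_of_pos hpq
      gcongr
    · have := Real.log_lt_sub_one_of_pos hpq (fun h => hne ((div_eq_one_iff_eq hq.ne').1 h).symm)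
      gcongr

variable {D : ℕ} {E : ℕ → ℝ} {β ρ c : ℝ}

/-- Since `log (p i)` is affine in `i` and `E i`, the two constraints on `q` evaluate `∑ q i log (p
i)` up to the energy term. What remains of `J` is the relative entropy of `q` with respect to `p`.
-/
theorem freeEnergy_eq (hρ : 0 < ρ) (hc : 0 < c) {p q : Fin (D + 1) → ℝ}
    (hp : ∀ i : Fin (D + 1), p i = c * Real.exp (-β * E i) * ρ ^ (i : ℕ))
    (hq : q ∈ meanOneSimplex D) :
    freeEnergy E β q = ∑ i, (q i * Real.log (q i) - q i * Real.log (p i)) + Real.log (c * ρ) := by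
  have hlog : ∀ i, Real.log (p i) = Real.log c - β * E i + (i : ℕ) * Real.log ρ := by
    intro i
    rw [hp, Real.log_mul (by positivity) (by positivity), Real.log_mul hc.ne' (Real.exp_ne_zero _),
      Real.log_exp, Real.log_pow]
    ring
  have h1 : ∑ i, q i * Real.log (p i) = Real.log c - β * ∑ i, q i * E i + Real.log ρ := by
    have : ∀ i, q i * Real.log (p i) =
        Real.log c * q i - β * (q i * E i) + Real.log ρ * ((i : ℕ) * q i) := by
      intro i; rw [hlog]; ring
    simp only [this, Finset.sum_add_distrib, Finset.sum_sub_distrib, ← Finset.mul_sum, hq.2.1,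
      hq.2.2, mul_one]
  rw [Finset.sum_sub_distrib, h1, freeEnergy, entropy, Real.log_mul hc.ne' hρ.ne']
  ring

theorem freeEnergy_self (hρ : 0 < ρ) (hc : 0 < c) {p : Fin (D + 1) → ℝ}
    (hp : ∀ i : Fin (D + 1), p i = c * Real.exp (-β * E i) * ρ ^ (i : ℕ))
    (hpΔ : p ∈ meanOneSimplex D) : freeEnergy E β p = Real.log (c * ρ) := by
  rw [freeEnergy_eq hρ hc hp hpΔ]
  simp

theorem freeEnergy_lt (hρ : 0 < ρ) (hc : 0 < c) {p q : Fin (D + 1) → ℝ}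
    (hp : ∀ i : Fin (D + 1), p i = c * Real.exp (-β * E i) * ρ ^ (i : ℕ))
    (hpΔ : p ∈ meanOneSimplex D) (hq : q ∈ meanOneSimplex D) (hne : q ≠ p) :
    freeEnergy E β p < freeEnergy E β q := by
  rw [freeEnergy_self hρ hc hp hpΔ, freeEnergy_eq hρ hc hp hq]
  have hp0 : ∀ i, 0 < p i := fun i => by rw [hp]; positivity
  obtain ⟨j, hj⟩ := Function.ne_iff.1 hne
  have : ∑ i, (q i - p i) < ∑ i, (q i * Real.log (q i) - q i * Real.log (p i)) :=
    Finset.sum_lt_sum (fun i _ => (mul_log_sub_mul_log_ge (hq.1 i).1 (hp0 i)).1)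
      ⟨j, Finset.mem_univ j, (mul_log_sub_mul_log_ge (hq.1 j).1 (hp0 j)).2 hj⟩
  rw [Finset.sum_sub_distrib, hq.2.1, hpΔ.2.1] at this
  linarith

end Variational

/-! ### Measures on a countable discrete space carried by a finite set -/

section Measures

theorem isFiniteMeasure_sum_dirac (s : Finset PlaneTree) (f : PlaneTree → ℝ) :
    IsFiniteMeasure (∑ T ∈ s, ENNReal.ofReal (f T) • Measure.dirac T) := by
  refine ⟨?_⟩
  rw [Measure.finsetSum_apply]
  refine ENNReal.sum_lt_top.2 fun T _ => ?_
  simp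

open Classical in
theorem sum_dirac_real (s : Finset PlaneTree) (f : PlaneTree → ℝ) (hf : ∀ T ∈ s, 0 ≤ f T)
    (A : Set PlaneTree) :
    (∑ T ∈ s, ENNReal.ofReal (f T) • Measure.dirac T).real A = ∑ T ∈ s with T ∈ A, f T := by
  rw [Measure.real, Measure.finsetSum_apply, ENNReal.toReal_sum, Finset.sum_filter]
  · refine Finset.sum_congr rfl fun T hT => ?_
    by_cases h : T ∈ A <;> simp [h, hf T hT]
  · intro T _
    by_cases h : T ∈ A <;> simp [h]

open Classical in
theorem real_eq_sum_of_carried {μ : Measure PlaneTree} [IsFiniteMeasure μ] {S : Set PlaneTree}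
    (hS : S.Finite) (hμ : μ Sᶜ = 0) (A : Set PlaneTree) :
    μ.real A = ∑ τ ∈ hS.toFinset with τ ∈ A, μ.real {τ} := by
  rw [sum_measureReal_singleton, Measure.real, Measure.real, ← measure_inter_conull hμ]
  congr 2
  ext τ
  simp [and_comm]

theorem abs_sub_le_tvDist (μ ν : Measure PlaneTree) [IsFiniteMeasure μ] [IsFiniteMeasure ν]
    (A : Set PlaneTree) : |μ.real A - ν.real A| ≤ tvDist μ ν := by
  -- A real supremum is zero by default when unbounded, so an explicit bound, the sum of the total
  -- masses, is supplied.
  refine le_ciSup (f := fun A : {A : Set PlaneTree // MeasurableSet A} =>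
    |μ.real A - ν.real A|) ⟨μ.real Set.univ + ν.real Set.univ, ?_⟩ ⟨A, trivial⟩
  rintro _ ⟨B, rfl⟩
  have h1 : μ.real B ≤ μ.real Set.univ := measureReal_mono (Set.subset_univ _)
  have h2 : ν.real B ≤ ν.real Set.univ := measureReal_mono (Set.subset_univ _)
  have h3 : 0 ≤ μ.real B := measureReal_nonneg
  have h4 : 0 ≤ ν.real B := measureReal_nonneg
  simp only
  rw [abs_le]
  constructor <;> linarith

theorem tvDist_nonneg (μ ν : Measure PlaneTree) : 0 ≤ tvDist μ ν :=
  Real.iSup_nonneg fun _ => abs_nonneg _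

theorem tvDist_le_sum {μ ν : Measure PlaneTree} [IsFiniteMeasure μ] [IsFiniteMeasure ν]
    {S : Set PlaneTree} (hS : S.Finite) (hμ : μ Sᶜ = 0) (hν : ν Sᶜ = 0) :
    tvDist μ ν ≤ ∑ τ ∈ hS.toFinset, |μ.real {τ} - ν.real {τ}| := by
  classical
  refine Real.iSup_le (fun A => ?_) (Finset.sum_nonneg fun _ _ => abs_nonneg _)
  rw [real_eq_sum_of_carried hS hμ, real_eq_sum_of_carried hS hν, ← Finset.sum_sub_distrib]
  exact (Finset.abs_sum_le_sum_abs _ _).trans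
    (Finset.sum_le_sum_of_subset_of_nonneg (Finset.filter_subset _ _) fun _ _ _ => abs_nonneg _)

theorem ext_of_carried {μ ν : Measure PlaneTree} [IsFiniteMeasure μ] [IsFiniteMeasure ν]
    {S : Set PlaneTree} (hS : S.Finite) (hμ : μ Sᶜ = 0) (hν : ν Sᶜ = 0)
    (h : ∀ τ ∈ S, μ.real {τ} = ν.real {τ}) : μ = ν := by
  classical
  ext A -
  have : μ.real A = ν.real A := by
    rw [real_eq_sum_of_carried hS hμ, real_eq_sum_of_carried hS hν]
    refine Finset.sum_congr rfl fun τ hτ => h τ ?_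
    simpa using (Finset.mem_filter.1 hτ).1
  exact (measureReal_eq_measureReal_iff).1 this

end Measures

/-! ### The thermodynamic limit -/

section Limit

variable (D : ℕ) (E : ℕ → ℝ) (β : ℝ)

instance isFiniteMeasure_gibbs (N : ℕ) : IsFiniteMeasure (gibbs D E β N) :=
  isFiniteMeasure_sum_dirac _ fun T => Real.exp (-β * T.energy E) / partitionFn D E β N

open Classical in
theorem gibbs_real (N : ℕ) (A : Set PlaneTree) : (gibbs D E β N).real A =
    (∑ T ∈ trees D N with T ∈ A, treeWeight E β T) / partitionFn D E β N := by
  have h : 0 ≤ partitionFn D E β N := Finset.sum_nonneg fun _ _ => (Real.exp_pos _).le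
  rw [gibbs, sum_dirac_real _ (fun T => Real.exp (-β * T.energy E) / partitionFn D E β N)
    (fun T _ => by positivity), Finset.sum_div]
  rfl

theorem measurable_trunc (n : ℕ) : Measurable (trunc n) := fun _ _ => trivial

theorem partitionFn_eq_coeff (N : ℕ) :
    partitionFn D E β N = PowerSeries.coeff N (allGF E β D) := by
  classical
  have := coeff_treeGF E β Set.univ D N
  simp only [Set.mem_univ, and_true, Finset.filter_true] at this
  rw [allGF, this]
  rfl

theorem map_gibbs_real_singleton {n : ℕ} {τ : PlaneTree} (hτ : τ ∈ treesOfHeight D n) (N : ℕ) :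
    ((gibbs D E β N).map (trunc n)).real {τ} = Real.exp (-β * τ.energyBelow E n) *
      (PowerSeries.coeff N (PowerSeries.X ^ τ.numBelow n * allGF E β D ^ τ.numAt n) /
        PowerSeries.coeff N (allGF E β D)) := by
  classical
  rw [map_measureReal_apply (measurable_trunc n) trivial, gibbs_real, ← coeff_treeGF,
    partitionFn_eq_coeff, ← mul_div_assoc, ← PowerSeries.coeff_C_mul, ← mul_assoc,
    ← treeGF_trunc E β D n τ hτ.1.le hτ.2]
  rfl

theorem eventually_carried_map_gibbs (n : ℕ) :
    ∀ᶠ N in atTop, (gibbs D E β N).map (trunc n) (treesOfHeight D n)ᶜ = 0 := by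
  classical
  filter_upwards [eventually_trunc_mem D n] with N hN
  rw [← measureReal_eq_zero_iff, map_measureReal_apply (measurable_trunc n) trivial, gibbs_real,
    Finset.sum_eq_zero, zero_div]
  intro T hT
  rw [Finset.mem_filter] at hT
  exact absurd (hN T hT.1) hT.2

variable {D E β}

/-- Pointwise convergence on the finite set `S_n` gives the limit measure. -/
theorem existsUnique_isLimitMeasure {n : ℕ} {f : PlaneTree → ℝ}
    (hZ : ∀ᶠ N in atTop, partitionFn D E β N ≠ 0)
    (hf : ∀ τ ∈ treesOfHeight D n, Tendsto
      (fun N => ((gibbs D E β N).map (trunc n)).real {τ}) atTop (𝓝 (f τ))) :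
    HasSum (fun τ : treesOfHeight D n => f τ) 1 ∧
    (∃! P : Measure PlaneTree, IsLimitMeasure D E β n P) ∧
    ∀ P : Measure PlaneTree, IsLimitMeasure D E β n P →
      ∀ τ ∈ treesOfHeight D n, P.real {τ} = f τ := by
  classical
  have hS := finite_treesOfHeight D n
  have hcar := eventually_carried_map_gibbs D E β n
  have hf0 : ∀ τ ∈ treesOfHeight D n, 0 ≤ f τ := fun τ hτ =>
    ge_of_tendsto' (hf τ hτ) fun _ => measureReal_nonneg
  have hval : ∀ P : Measure PlaneTree, IsLimitMeasure D E β n P →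
      ∀ τ ∈ treesOfHeight D n, P.real {τ} = f τ := by
    intro P hP τ hτ
    have := hP.isProbabilityMeasure
    refine tendsto_nhds_unique ?_ (hf τ hτ)
    rw [tendsto_iff_norm_sub_tendsto_zero]
    exact squeeze_zero (fun _ => norm_nonneg _) (fun N => abs_sub_le_tvDist _ _ _) hP.tendsto
  -- No mass escapes from the finite set `S_n`, so the normalisation passes to the limit without
  -- summing over trees.
  have hsum : ∑ τ ∈ hS.toFinset, f τ = 1 := by
    have h1 : Tendsto (fun N => ∑ τ ∈ hS.toFinset, ((gibbs D E β N).map (trunc n)).real {τ}) atTop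
        (𝓝 (∑ τ ∈ hS.toFinset, f τ)) :=
      tendsto_finsetSum _ fun τ hτ => hf τ (by simpa using hτ)
    refine tendsto_nhds_unique h1 ((tendsto_const_nhds (x := (1 : ℝ))).congr' ?_)
    filter_upwards [hZ, hcar] with N hN hN'
    have h2 := real_eq_sum_of_carried hS hN' Set.univ
    simp only [Set.mem_univ, Finset.filter_true] at h2
    rw [← h2, map_measureReal_apply (measurable_trunc n) trivial, Set.preimage_univ, gibbs_real]
    simp only [Set.mem_univ, Finset.filter_true]
    exact (div_self hN).symm
  refine ⟨?_, ?_, hval⟩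
  · have := hS.fintype
    have e : ∑ τ : treesOfHeight D n, f τ = 1 := by
      rw [← hsum]
      exact (Finset.sum_subtype hS.toFinset (fun τ => by simp) f).symm
    rw [← e]
    exact hasSum_fintype _
  · set P : Measure PlaneTree := ∑ τ ∈ hS.toFinset, ENNReal.ofReal (f τ) • Measure.dirac τ with hP
    have hfin : IsFiniteMeasure P := isFiniteMeasure_sum_dirac _ f
    have hreal : ∀ A, P.real A = ∑ τ ∈ hS.toFinset with τ ∈ A, f τ :=
      sum_dirac_real _ f fun τ hτ => hf0 τ (by simpa using hτ)
    have hPc : P (treesOfHeight D n)ᶜ = 0 := by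
      rw [← measureReal_eq_zero_iff, hreal, Finset.sum_filter]
      exact Finset.sum_eq_zero fun τ hτ => if_neg fun h => h (hS.mem_toFinset.1 hτ)
    have hPs : ∀ τ ∈ treesOfHeight D n, P.real {τ} = f τ := by
      intro τ hτ
      rw [hreal, Finset.sum_filter]
      simp [hτ]
    refine ⟨P, ⟨⟨?_⟩, hPc, hcar, ?_⟩, ?_⟩
    · have := hreal Set.univ
      simp only [Set.mem_univ, Finset.filter_true, hsum] at this
      rw [← ENNReal.toReal_eq_one_iff]
      exact this
    · have h1 : Tendsto (fun N => ∑ τ ∈ hS.toFinset,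
          |((gibbs D E β N).map (trunc n)).real {τ} - P.real {τ}|) atTop
          (𝓝 (∑ τ ∈ hS.toFinset, 0)) := by
        refine tendsto_finsetSum _ fun τ hτ => ?_
        have hτ' : τ ∈ treesOfHeight D n := by simpa using hτ
        have := tendsto_iff_norm_sub_tendsto_zero.1 (hf τ hτ')
        rwa [← hPs τ hτ'] at this
      rw [Finset.sum_const_zero] at h1
      refine squeeze_zero' (Eventually.of_forall fun _ => tvDist_nonneg _ _) ?_ h1
      filter_upwards [hcar] with N hN
      exact tvDist_le_sum hS hN hPc
    · intro P' hP'
      have := hP'.isProbabilityMeasure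
      exact ext_of_carried hS hP'.carried hPc fun τ hτ => by rw [hval P' hP' τ hτ, hPs τ hτ]

end Limit

end GibbsTree

end

/-! ### The main theorem. -/

theorem theorem5 (D : ℕ) (hD : 2 ≤ D) (E : ℕ → ℝ) (β : ℝ) :
    -- the unique minimiser of `J` over `Δ`
    ∃ p ∈ GibbsTree.meanOneSimplex D,
      (∀ q ∈ GibbsTree.meanOneSimplex D, q ≠ p →
        GibbsTree.freeEnergy E β p < GibbsTree.freeEnergy E β q) ∧
    -- its Lagrange form, which determines `ρ` and `C`
    ∃ ρ C σ : ℝ, 0 < ρ ∧ 0 < C ∧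
      (∀ i : Fin (D + 1), p i = C * Real.exp (-β * E i) * ρ ^ (i : ℕ)) ∧
      (∀ r : ℝ, 0 < r →
        (∑ i ∈ Finset.range (D + 1), Real.exp (-β * E i) * r ^ i =
          ∑ i ∈ Finset.range (D + 1), i * Real.exp (-β * E i) * r ^ i ↔ r = ρ)) ∧
      1 / C = ∑ i ∈ Finset.range (D + 1), Real.exp (-β * E i) * ρ ^ i ∧
      1 / C = ∑ i ∈ Finset.range (D + 1), i * Real.exp (-β * E i) * ρ ^ i ∧
      σ = Real.exp (GibbsTree.freeEnergy E β p) ∧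
    -- the limit measures
    ∀ n : ℕ,
      (∃! P : MeasureTheory.Measure GibbsTree.PlaneTree, GibbsTree.IsLimitMeasure D E β n P) ∧
      ∀ P : MeasureTheory.Measure GibbsTree.PlaneTree, GibbsTree.IsLimitMeasure D E β n P →
        (∃ Q : ℝ,
          HasSum (fun τ : GibbsTree.treesOfHeight D n => Q * GibbsTree.weight E β ρ σ n τ) 1 ∧
          (∀ τ ∈ GibbsTree.treesOfHeight D n, P.real {τ} = Q * GibbsTree.weight E β ρ σ n τ) ∧
          Q = C / σ) ∧
        ∀ τ ∈ GibbsTree.treesOfHeight D n,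
          P.real {τ} = C * τ.numAt n * Real.exp (-β * τ.energyBelow E n) *
            ρ ^ τ.numAt n * σ ^ ((τ.numBelow n : ℤ) - 1) := by

  set w : ℕ → ℝ := fun i => Real.exp (-β * E i) with hw
  have hw0 : ∀ i, 0 < w i := fun i => Real.exp_pos _
  obtain ⟨ρ, hρ, hcrit⟩ := GibbsTree.exists_unique_critical hw0 hD
  set s := ∑ i ∈ Finset.range (D + 1), w i * ρ ^ i with hs
  have hs' : s = ∑ i ∈ Finset.range (D + 1), i * w i * ρ ^ i := (hcrit ρ hρ).2 rfl
  have hs0 : 0 < s := Finset.sum_pos (fun i _ => mul_pos (hw0 i) (pow_pos hρ i)) ⟨0, by simp⟩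
  set c := 1 / s with hc
  have hc0 : 0 < c := one_div_pos.2 hs0
  have hcs : c * s = 1 := one_div_mul_cancel hs0.ne'
  have hsum : ∑ i ∈ Finset.range (D + 1), c * w i * ρ ^ i = 1 := by
    simp only [mul_assoc, ← Finset.mul_sum, ← hs, hcs]
  have hmean : ∑ i ∈ Finset.range (D + 1), i * (c * w i * ρ ^ i) = 1 := by
    rw [← hcs, hs', Finset.mul_sum]
    exact Finset.sum_congr rfl fun i _ => by ring
  set p : Fin (D + 1) → ℝ := fun i => c * Real.exp (-β * E i) * ρ ^ (i : ℕ) with hp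
  have hpnn : ∀ i, 0 ≤ p i := fun i => by positivity
  have hpsum : ∑ i, p i = 1 := by
    rw [← hsum, Finset.sum_range]
  have hpΔ : p ∈ GibbsTree.meanOneSimplex D := by
    refine ⟨fun i => ⟨hpnn i, ?_⟩, hpsum, ?_⟩
    · rw [← hpsum]
      exact Finset.single_le_sum (fun j _ => hpnn j) (Finset.mem_univ i)
    · rw [← hmean, Finset.sum_range]
  have hσ : Real.exp (GibbsTree.freeEnergy E β p) = c * ρ := by
    rw [GibbsTree.freeEnergy_self hρ hc0 (fun _ => rfl) hpΔ, Real.exp_log (mul_pos hc0 hρ)]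
  refine ⟨p, hpΔ, fun q hq hne => GibbsTree.freeEnergy_lt hρ hc0 (fun _ => rfl) hpΔ hq hne,
    ρ, c, c * ρ, hρ, hc0, fun _ => rfl, hcrit, ?_, ?_, hσ.symm, fun n => ?_⟩
  · rw [hc, one_div_one_div]
  · rw [hc, one_div_one_div, hs']
  have hratio := GibbsTree.tendsto_coeff_ratio hw0 (by omega) hρ hc0 hsum hmean
    (GibbsTree.allGF_eq E β D)
  -- For `m = 0`, `k = 1` the ratio is `Z_N / Z_N`, which tends to `1`; were `Z_N` zero, division by
  -- zero would make it `0`.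
  have hZ : ∀ᶠ N in Filter.atTop, GibbsTree.partitionFn D E β N ≠ 0 := by
    have h1 := hratio 0 1
    have h2 : ((1 : ℕ) : ℝ) * ρ ^ 1 / ρ * (c * ρ) ^ 0 ≠ 0 := by
      simp [hρ.ne']
    filter_upwards [h1.eventually_ne h2] with N hN h
    rw [GibbsTree.partitionFn_eq_coeff] at h
    rw [h, div_zero] at hN
    exact hN rfl
  have hlim : ∀ τ ∈ GibbsTree.treesOfHeight D n, Filter.Tendsto
      (fun N => ((GibbsTree.gibbs D E β N).map (GibbsTree.PlaneTree.trunc n)).real {τ}) Filter.atTop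
      -- The prefactor is `1/ρ`, contributed by `[x^N] T` in the denominator.
      (nhds (c / (c * ρ) * GibbsTree.weight E β ρ (c * ρ) n τ)) := by
    intro τ hτ
    simp only [GibbsTree.map_gibbs_real_singleton D E β hτ]
    have h := (hratio (τ.numBelow n) (τ.numAt n)).const_mul (Real.exp (-β * τ.energyBelow E n))
    convert h using 2
    rw [GibbsTree.weight]
    field_simp
  obtain ⟨h1, h2, h3⟩ := GibbsTree.existsUnique_isLimitMeasure hZ hlim
  refine ⟨h2, fun P hP => ⟨⟨c / (c * ρ), h1, h3 P hP, rfl⟩, fun τ hτ => ?_⟩⟩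
  -- The exponent `m - 1` is an integer power because `m = 0` when `n = 0`.
  rw [h3 P hP τ hτ, GibbsTree.weight, zpow_sub₀ (mul_pos hc0 hρ).ne', zpow_natCast, zpow_one]
  field_simp
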